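/- **Setting.** Manifolds are smooth, finite-dimensional, Hausdorff, second countable and without boundary. Let $M$ be a manifold. A *path* $\gamma:x\to y$ in $M$ is a smooth map $\gamma:[0,1]\to M$ which is constantly $x$ near $0$ and constantly $y$ near $1$; $PM$ is the set of paths. Two paths $x\to y$ are *thin homotopic* if there is a smooth $h:[0,1]^2\to M$ and $0<\epsilon<\frac12$ with $h(s,t)=x$ for $t<\epsilon$, $h(s,t)=y$ for $t>1-\epsilon$, $h(s,t)=\gamma_1(t)$ for $s<\epsilon$, $h(s,t)=\gamma_2(t)$ for $s>1-\epsilon$, and $\operatorname{rank}\mathrm dh\le 1$ everywhere. The *path groupoid* $\mathcal P_1(M)$ has the points of $M$ as objects and thin homotopy classes of paths as morphisms, composed by concatenation; a smooth map $f$ induces a functor $f_*$ of path groupoids, and $f^*F:=F\circ f_*$. Let $\mathrm{Gr}$ be a Lie groupoid (a groupoid whose sets of objects and of morphisms are smooth manifolds, possibly with components of different dimensions, whose source and target maps are surjective submersions, and whose composition and identity maps are smooth), let $T$ be a category, and let $i:\mathrm{Gr}\to T$ be a functor. A functor $F:\mathcal P_1(X)\to\mathrm{Gr}$ is *smooth*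 if it is smooth on objects and if for every open $U\subset\mathbb R^k$ and every $c:U\to PX$ with $(u,t)\mapsto c(u)(t)$ smooth on $U\times[0,1]$ the map $u\mapsto F(\overline{c(u)})\in\mathrm{Mor}(\mathrm{Gr})$ is smooth; a natural transformation between such functors is *smooth* if its components form a smooth map $X\to\mathrm{Mor}(\mathrm{Gr})$. Let $\pi:Y\to M$ be a surjective submersion, with projections $\pi_1,\pi_2:Y^{[2]}=Y\times_MY\to Y$. A *$\pi$-local $i$-trivialization* of $F:\mathcal P_1(M)\to T$ is a pair $(\mathrm{triv},t)$ of a functor $\mathrm{triv}:\mathcal P_1(Y)\to\mathrm{Gr}$ and a natural equivalence $t:\pi^*F\to i\circ\mathrm{triv}$. Its *descent data* is $\mathrm{triv}$ together with the natural equivalence $g:\pi_1^*(i\circ\mathrm{triv})\to\pi_2^*(i\circ\mathrm{triv})$ with components $g(y,y')=t(y')\circ t(y)^{-1}$. It is *smooth* if $\mathrm{triv}$ is smooth and $g=i(\tilde g)$ for a smooth natural equivalence $\tilde g:\pi_1^*\mathrm{triv}\to\pi_2^*\mathrm{triv}$. The descent datum of a natural transformation $\alpha:F\to F'$ between functors with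 $\pi$-local $i$-trivializations $(\mathrm{triv},t)$, $(\mathrm{triv}',t')$ is $h:i\circ\mathrm{triv}\to i\circ\mathrm{triv}'$, $h(y)=t'(y)\circ\alpha(\pi(y))\circ t(y)^{-1}$; it is *smooth* if $h=i(\tilde h)$ for a smooth natural equivalence $\tilde h:\mathrm{triv}\to\mathrm{triv}'$. Let $\mathrm{Triv}^1_\pi(i)^\infty$ be the category of triples $(F,\mathrm{triv},t)$ of a functor $F:\mathcal P_1(M)\to T$ and a $\pi$-local $i$-trivialization with smooth descent data, with the natural transformations having smooth descent datum as morphisms. A *transport functor* on $M$ in $T$ with $\mathrm{Gr}$-structure is a functor $\mathcal P_1(M)\to T$ that admits, for some surjective submersion over $M$, a local $i$-trivialization with smooth descent data. A *morphism of transport functors* is a natural equivalence $\eta:F\to F'$ such that, for some surjective submersion over $M$, there are local $i$-trivializations of $F$ and $F'$ with smooth descent data for which the descent datum of $\eta$ is smooth. A surjective submersion $\pi:Y\to M$ is *contractible* if there is a smooth map $c:Y\times[0,1]\to Y$ with $c(y,0)=y$ for all $y$ and $c(y,1)=y_k$ for all $y$ in the connected component $Y_k$ of $Y$, for some fixed choice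 of a point $y_k\in Y_k$ for each component. **Proposition.** Let $i:\mathrm{Gr}\to T$ be an equivalence of categories and let $\pi:Y\to M$ be a contractible surjective submersion. Then identities and composites of morphisms of transport functors are morphisms of transport functors, so that transport functors on $M$ in $T$ with $\mathrm{Gr}$-structure form a category $\mathrm{Trans}^1_{\mathrm{Gr}}(M,T)$, and the forgetful functor $$v^\infty:\mathrm{Triv}^1_\pi(i)^\infty\to\mathrm{Trans}^1_{\mathrm{Gr}}(M,T),\qquad (F,\mathrm{triv},t)\mapsto F,$$ is a surjective equivalence of categories: it is an equivalence of categories, and it is surjective on objects, i.e. every transport functor on $M$ in $T$ with $\mathrm{Gr}$-structure admits a $\pi$-local $i$-trivialization with smooth descent data. -/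

import Mathlib

open CategoryTheory Set Topology
open scoped Manifold ContDiff

universe u v w u₁ v₁ u₂ v₂

/- Transport functors on a smooth manifold with structure Lie groupoid.

Manifolds are finite-dimensional, smooth and without boundary, modelled on `EuclideanSpace ℝ (Fin n)`.
Some spaces are embedded submanifolds of an ambient manifold (an open subset of Euclidean space, the
fibre product of a submersion with itself). To treat them together with manifolds, smoothness on a
type `X` is always expressed through an injection `ι : X → N` into a manifold `N`, with `X` carrying
the smooth structure induced from `N`. For a manifold `M` itself one takes `ι = id : M → M`.
-/

namespace Transport

section Paths

variable {E H N X : Type*} [NormedAddCommGroup E] [NormedSpace ℝ E] [TopologicalSpace H]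
  [TopologicalSpace N] [ChartedSpace H N]

/-- A path in `X` from `x` to `y`: a smooth map on `[0,1]` with sitting instants, constantly `x` near
`0` and constantly `y` near `1`. Because of the sitting instants such a map extends in exactly one
way to a smooth map on the whole line that is constantly `x` on `t ≤ 0` and constantly `y` on `1 ≤ t`;
we record this extension. -/
structure SPath (I : ModelWithCorners ℝ E H) (ι : X → N) (x y : X) where
  toFun : ℝ → X
  smooth : ContMDiff 𝓘(ℝ, ℝ) I ∞ (ι ∘ toFun)
  sitting : ∃ ε : ℝ, 0 < ε ∧ ε < 1 / 2 ∧
    (∀ t, t < ε → toFun t = x) ∧ (∀ t, 1 - ε < t → toFun t = y)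

/-- The differential of `h : ℝ × ℝ → X` has rank at most one everywhere. -/
def RankLEOne (I : ModelWithCorners ℝ E H) (ι : X → N) (h : ℝ × ℝ → X) : Prop :=
  ∀ p, LinearMap.rank (mfderiv 𝓘(ℝ, ℝ × ℝ) I (ι ∘ h) p : (ℝ × ℝ) →L[ℝ] E).toLinearMap ≤ 1

/-- Thin homotopy of paths: a smooth homotopy on the square, with sitting instants on all four sides
and with differential of rank at most one. As for paths, the homotopy is extended from the square to
the plane, constantly in the direction normal to each side; the sitting instants make this extension
smooth and unique. -/
def SPath.ThinHomotopic {I : ModelWithCorners ℝ E H} {ι : X → N} {x y : X}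
    (γ₁ γ₂ : SPath I ι x y) : Prop :=
  ∃ h : ℝ × ℝ → X, ContMDiff 𝓘(ℝ, ℝ × ℝ) I ∞ (ι ∘ h) ∧
    (∃ ε : ℝ, 0 < ε ∧ ε < 1 / 2 ∧
      (∀ s t, t < ε → h (s, t) = x) ∧ (∀ s t, 1 - ε < t → h (s, t) = y) ∧
      (∀ s t, s < ε → h (s, t) = γ₁.toFun t) ∧
      (∀ s t, 1 - ε < s → h (s, t) = γ₂.toFun t)) ∧
    RankLEOne I ι h

variable {I : ModelWithCorners ℝ E H} {ι : X → N}

/-- The rank condition is stable under smooth reparametrization of the source. -/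
theorem RankLEOne.precomp {h : ℝ × ℝ → X} (hr : RankLEOne I ι h)
    (hs : ContMDiff 𝓘(ℝ, ℝ × ℝ) I ∞ (ι ∘ h)) {φ : ℝ × ℝ → ℝ × ℝ} (hφ : ContDiff ℝ ∞ φ) :
    RankLEOne I ι (h ∘ φ) := by
  intro p
  have h1 : MDifferentiableAt 𝓘(ℝ, ℝ × ℝ) I (ι ∘ h) (φ p) :=
    hs.mdifferentiable (by simp) _
  have h2 : MDifferentiableAt 𝓘(ℝ, ℝ × ℝ) 𝓘(ℝ, ℝ × ℝ) φ p :=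
    hφ.contMDiff.mdifferentiable (by simp) _
  have h3 : (mfderiv 𝓘(ℝ, ℝ × ℝ) I (ι ∘ h ∘ φ) p : (ℝ × ℝ) →L[ℝ] E) =
      (mfderiv 𝓘(ℝ, ℝ × ℝ) I (ι ∘ h) (φ p) : (ℝ × ℝ) →L[ℝ] E).comp
        (mfderiv 𝓘(ℝ, ℝ × ℝ) 𝓘(ℝ, ℝ × ℝ) φ p : (ℝ × ℝ) →L[ℝ] (ℝ × ℝ)) :=
    mfderiv_comp p h1 h2
  rw [h3]
  exact (LinearMap.rank_comp_le_left _ _).trans (hr (φ p))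

/-- A map that factors through the line has rank at most one. -/
theorem rankLEOne_of_curve {Γ : ℝ → X} (hΓ : ContMDiff 𝓘(ℝ, ℝ) I ∞ (ι ∘ Γ))
    {a : ℝ × ℝ → ℝ} (ha : ContDiff ℝ ∞ a) : RankLEOne I ι (Γ ∘ a) := by
  intro p
  have h1 : MDifferentiableAt 𝓘(ℝ, ℝ) I (ι ∘ Γ) (a p) :=
    hΓ.mdifferentiable (by simp) _
  have h2 : MDifferentiableAt 𝓘(ℝ, ℝ × ℝ) 𝓘(ℝ, ℝ) a p :=
    ha.contMDiff.mdifferentiable (by simp) _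
  have h3 : (mfderiv 𝓘(ℝ, ℝ × ℝ) I (ι ∘ Γ ∘ a) p : (ℝ × ℝ) →L[ℝ] E) =
      (mfderiv 𝓘(ℝ, ℝ) I (ι ∘ Γ) (a p) : ℝ →L[ℝ] E).comp
        (mfderiv 𝓘(ℝ, ℝ × ℝ) 𝓘(ℝ, ℝ) a p : (ℝ × ℝ) →L[ℝ] ℝ) :=
    mfderiv_comp p h1 h2
  rw [h3]
  refine (LinearMap.rank_comp_le_left _ _).trans ?_
  have := lift_rank_range_le (mfderiv 𝓘(ℝ, ℝ) I (ι ∘ Γ) (a p) : ℝ →L[ℝ] E).toLinearMap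
  have h4 : Module.rank ℝ (TangentSpace 𝓘(ℝ, ℝ) (a p)) = 1 := Module.rank_self ℝ
  rw [h4, Cardinal.lift_one] at this
  exact Cardinal.lift_le_one_iff.1 this

/-- Having rank at most one is local. -/
theorem rankLEOne_of_eventuallyEq {h : ℝ × ℝ → X}
    (H : ∀ p, ∃ k : ℝ × ℝ → X, RankLEOne I ι k ∧ h =ᶠ[𝓝 p] k) : RankLEOne I ι h := by
  intro p
  obtain ⟨k, hk, e⟩ := H p
  have e' : ι ∘ h =ᶠ[𝓝 p] ι ∘ k := e.fun_comp ι
  have h3 : (mfderiv 𝓘(ℝ, ℝ × ℝ) I (ι ∘ h) p : (ℝ × ℝ) →L[ℝ] E) =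
    (mfderiv 𝓘(ℝ, ℝ × ℝ) I (ι ∘ k) p : (ℝ × ℝ) →L[ℝ] E) := e'.mfderiv_eq
  rw [h3]
  exact hk p

/-- Being smooth is local. -/
theorem contMDiff_of_eventuallyEq {V : Type*} [NormedAddCommGroup V] [NormedSpace ℝ V]
    {h : V → X}
    (H : ∀ p, ∃ k : V → X, ContMDiff 𝓘(ℝ, V) I ∞ (ι ∘ k) ∧ h =ᶠ[𝓝 p] k) :
    ContMDiff 𝓘(ℝ, V) I ∞ (ι ∘ h) := by
  intro p
  obtain ⟨k, hk, e⟩ := H p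
  exact (hk p).congr_of_eventuallyEq (e.fun_comp ι)

namespace SPath

variable {x y z : X}

theorem ThinHomotopic.refl (γ : SPath I ι x y) : γ.ThinHomotopic γ := by
  obtain ⟨ε, h0, h1, h2, h3⟩ := γ.sitting
  refine ⟨fun p ↦ γ.toFun p.2, ?_, ⟨ε, h0, h1, fun _ t ht ↦ h2 t ht, fun _ t ht ↦ h3 t ht,
    fun _ _ _ ↦ rfl, fun _ _ _ ↦ rfl⟩, ?_⟩
  · exact γ.smooth.comp (contDiff_snd.contMDiff)
  · exact rankLEOne_of_curve γ.smooth contDiff_snd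

theorem ThinHomotopic.symm {γ₁ γ₂ : SPath I ι x y} (h : γ₁.ThinHomotopic γ₂) :
    γ₂.ThinHomotopic γ₁ := by
  obtain ⟨h, hs, ⟨ε, h0, h1, h2, h3, h4, h5⟩, hr⟩ := h
  have hφ : ContDiff ℝ ∞ (fun p : ℝ × ℝ ↦ (1 - p.1, p.2)) := by fun_prop
  refine ⟨h ∘ fun p ↦ (1 - p.1, p.2), hs.comp hφ.contMDiff, ⟨ε, h0, h1, ?_, ?_, ?_, ?_⟩,
    hr.precomp hs hφ⟩
  · exact fun s t ht ↦ h2 _ t ht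
  · exact fun s t ht ↦ h3 _ t ht
  · exact fun s t ht ↦ h5 _ t (by linarith)
  · exact fun s t ht ↦ h4 _ t (by linarith)

theorem ThinHomotopic.trans {γ₁ γ₂ γ₃ : SPath I ι x y} (h : γ₁.ThinHomotopic γ₂)
    (k : γ₂.ThinHomotopic γ₃) : γ₁.ThinHomotopic γ₃ := by
  obtain ⟨h, hs, ⟨ε, h0, h1, h2, h3, h4, h5⟩, hr⟩ := h
  obtain ⟨k, ks, ⟨δ, k0, k1, k2, k3, k4, k5⟩, kr⟩ := k
  have hφ : ContDiff ℝ ∞ (fun p : ℝ × ℝ ↦ (2 * p.1, p.2)) := by fun_prop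
  have hψ : ContDiff ℝ ∞ (fun p : ℝ × ℝ ↦ (2 * p.1 - 1, p.2)) := by fun_prop
  set f : ℝ × ℝ → X := fun p ↦ if p.1 < 1 / 2 then h (2 * p.1, p.2) else k (2 * p.1 - 1, p.2)
    with hf
  have key : ∀ p : ℝ × ℝ, f =ᶠ[𝓝 p] (h ∘ fun p : ℝ × ℝ ↦ (2 * p.1, p.2)) ∨
      f =ᶠ[𝓝 p] (k ∘ fun p : ℝ × ℝ ↦ (2 * p.1 - 1, p.2)) := by
    intro p
    by_cases hp : p.1 < 1 / 2
    · left
      have : ∀ᶠ q : ℝ × ℝ in 𝓝 p, q.1 < 1 / 2 :=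
        continuous_fst.continuousAt.eventually_lt continuousAt_const hp
      filter_upwards [this] with q hq
      simp only [hf, if_pos hq, Function.comp]
    · right
      push Not at hp
      have : ∀ᶠ q : ℝ × ℝ in 𝓝 p, (1 / 2 - min ε δ / 2) < q.1 :=
        continuousAt_const.eventually_lt continuous_fst.continuousAt
          (by have := lt_min h0 k0; linarith)
      filter_upwards [this] with q hq
      by_cases hq' : q.1 < 1 / 2
      · have e1 := min_le_left ε δ
        have e2 := min_le_right ε δ
        simp only [hf, hq', if_true, Function.comp]
        rw [h5 _ _ (by linarith), k4 _ _ (by linarith)]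
      · simp only [hf, if_neg hq', Function.comp]
  refine ⟨f, ?_, ⟨min ε δ / 2, by positivity, ?_, ?_, ?_, ?_, ?_⟩, ?_⟩
  · refine contMDiff_of_eventuallyEq fun p ↦ ?_
    rcases key p with e | e
    · exact ⟨_, hs.comp hφ.contMDiff, e⟩
    · exact ⟨_, ks.comp hψ.contMDiff, e⟩
  · have := min_le_left ε δ; linarith
  · intro s t ht
    have e1 := min_le_left ε δ
    have e2 := min_le_right ε δ
    have := lt_min h0 k0
    simp only [hf]
    split_ifs
    · exact h2 _ _ (by linarith)
    · exact k2 _ _ (by linarith)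
  · intro s t ht
    have e1 := min_le_left ε δ
    have e2 := min_le_right ε δ
    have := lt_min h0 k0
    simp only [hf]
    split_ifs
    · exact h3 _ _ (by linarith)
    · exact k3 _ _ (by linarith)
  · intro s t hs
    have e1 := min_le_left ε δ
    have := lt_min h0 k0
    simp only [hf]
    rw [if_pos (by linarith)]
    exact h4 _ _ (by linarith)
  · intro s t hs
    have e2 := min_le_right ε δ
    have e1 := min_le_left ε δ
    have := lt_min h0 k0
    simp only [hf]
    rw [if_neg (by linarith)]
    exact k5 _ _ (by linarith)
  · refine rankLEOne_of_eventuallyEq fun p ↦ ?_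
    rcases key p with e | e
    · exact ⟨_, hr.precomp hs hφ, e⟩
    · exact ⟨_, kr.precomp ks hψ, e⟩

/-- The setoid of thin homotopy on the paths from `x` to `y`. -/
instance thinSetoid (I : ModelWithCorners ℝ E H) (ι : X → N) (x y : X) :
    Setoid (SPath I ι x y) where
  r := ThinHomotopic
  iseqv := ⟨ThinHomotopic.refl, ThinHomotopic.symm, ThinHomotopic.trans⟩

/-- The constant path. -/
def const (I : ModelWithCorners ℝ E H) (ι : X → N) (x : X) : SPath I ι x x where
  toFun := fun _ ↦ x
  smooth := contMDiff_const
  sitting := ⟨1 / 4, by norm_num, by norm_num, fun _ _ ↦ rfl, fun _ _ ↦ rfl⟩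

/-- The reversed path. -/
def reverse (γ : SPath I ι x y) : SPath I ι y x where
  toFun := fun t ↦ γ.toFun (1 - t)
  smooth := γ.smooth.comp
    (show ContDiff ℝ ∞ (fun t : ℝ ↦ 1 - t) by fun_prop).contMDiff
  sitting := by
    obtain ⟨ε, h0, h1, h2, h3⟩ := γ.sitting
    exact ⟨ε, h0, h1, fun t ht ↦ h3 _ (by linarith), fun t ht ↦ h2 _ (by linarith)⟩

/-- A concatenation of two curves that are constant near the gluing point is smooth. -/
theorem contMDiff_glue {f g : ℝ → X} {c ε : ℝ} (h0 : 0 < ε)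
    (hf : ContMDiff 𝓘(ℝ, ℝ) I ∞ (ι ∘ f)) (hg : ContMDiff 𝓘(ℝ, ℝ) I ∞ (ι ∘ g))
    (hfy : ∀ t, c - ε < t → f t = y) (hgy : ∀ t, t < c + ε → g t = y) :
    ContMDiff 𝓘(ℝ, ℝ) I ∞ (ι ∘ fun t ↦ if t ≤ c then f t else g t) := by
  refine contMDiff_of_eventuallyEq fun p ↦ ?_
  by_cases hp : p < c + ε
  · refine ⟨f, hf, ?_⟩
    filter_upwards [eventually_lt_nhds hp] with t ht
    split_ifs with h
    · rfl
    · rw [hgy t ht, hfy t (by linarith)]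
  · refine ⟨g, hg, ?_⟩
    filter_upwards [eventually_gt_nhds (show c < p by linarith)] with t ht
    rw [if_neg (by linarith)]

/-- Concatenation of paths: first `γ₁`, then `γ₂`, each at double speed. -/
noncomputable def concat (γ₁ : SPath I ι x y) (γ₂ : SPath I ι y z) : SPath I ι x z where
  toFun := fun t ↦ if t ≤ 1 / 2 then γ₁.toFun (2 * t) else γ₂.toFun (2 * t - 1)
  smooth := by
    obtain ⟨ε, h0, h1, h2, h3⟩ := γ₁.sitting
    obtain ⟨δ, k0, k1, k2, k3⟩ := γ₂.sitting
    have e1 := min_le_left ε δ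
    have e2 := min_le_right ε δ
    refine contMDiff_glue (y := y) (ε := min ε δ / 2) (by positivity)
      (γ₁.smooth.comp (show ContDiff ℝ ∞ (fun t : ℝ ↦ 2 * t) by fun_prop).contMDiff)
      (γ₂.smooth.comp (show ContDiff ℝ ∞ (fun t : ℝ ↦ 2 * t - 1) by fun_prop).contMDiff)
      (fun t ht ↦ h3 _ (by linarith)) (fun t ht ↦ k2 _ (by linarith))
  sitting := by
    obtain ⟨ε, h0, h1, h2, h3⟩ := γ₁.sitting
    obtain ⟨δ, k0, k1, k2, k3⟩ := γ₂.sitting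
    have e1 := min_le_left ε δ
    have e2 := min_le_right ε δ
    have e3 := lt_min h0 k0
    refine ⟨min ε δ / 2, by positivity, by linarith, fun t ht ↦ ?_, fun t ht ↦ ?_⟩
    · rw [if_pos (by linarith)]
      exact h2 _ (by linarith)
    · rw [if_neg (by linarith)]
      exact k3 _ (by linarith)

theorem ThinHomotopic.reverse {γ₁ γ₂ : SPath I ι x y} (h : γ₁.ThinHomotopic γ₂) :
    γ₁.reverse.ThinHomotopic γ₂.reverse := by
  obtain ⟨h, hs, ⟨ε, h0, h1, h2, h3, h4, h5⟩, hr⟩ := h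
  have hφ : ContDiff ℝ ∞ (fun p : ℝ × ℝ ↦ (p.1, 1 - p.2)) := by fun_prop
  refine ⟨h ∘ fun p ↦ (p.1, 1 - p.2), hs.comp hφ.contMDiff, ⟨ε, h0, h1, ?_, ?_, ?_, ?_⟩,
    hr.precomp hs hφ⟩
  · exact fun s t ht ↦ h3 _ _ (by linarith)
  · exact fun s t ht ↦ h2 _ _ (by linarith)
  · exact fun s t ht ↦ h4 _ _ ht
  · exact fun s t ht ↦ h5 _ _ ht

theorem ThinHomotopic.concat {γ₁ γ₁' : SPath I ι x y} {γ₂ γ₂' : SPath I ι y z}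
    (h : γ₁.ThinHomotopic γ₁') (k : γ₂.ThinHomotopic γ₂') :
    (γ₁.concat γ₂).ThinHomotopic (γ₁'.concat γ₂') := by
  obtain ⟨h, hs, ⟨ε, h0, h1, h2, h3, h4, h5⟩, hr⟩ := h
  obtain ⟨k, ks, ⟨δ, k0, k1, k2, k3, k4, k5⟩, kr⟩ := k
  have hφ : ContDiff ℝ ∞ (fun p : ℝ × ℝ ↦ (p.1, 2 * p.2)) := by fun_prop
  have hψ : ContDiff ℝ ∞ (fun p : ℝ × ℝ ↦ (p.1, 2 * p.2 - 1)) := by fun_prop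
  have e1 := min_le_left ε δ
  have e2 := min_le_right ε δ
  have e3 := lt_min h0 k0
  set f : ℝ × ℝ → X := fun p ↦ if p.2 ≤ 1 / 2 then h (p.1, 2 * p.2) else k (p.1, 2 * p.2 - 1)
    with hf
  have key : ∀ p : ℝ × ℝ, f =ᶠ[𝓝 p] (h ∘ fun p : ℝ × ℝ ↦ (p.1, 2 * p.2)) ∨
      f =ᶠ[𝓝 p] (k ∘ fun p : ℝ × ℝ ↦ (p.1, 2 * p.2 - 1)) := by
    intro p
    by_cases hp : p.2 < 1 / 2 + min ε δ / 2
    · left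
      have : ∀ᶠ q : ℝ × ℝ in 𝓝 p, q.2 < 1 / 2 + min ε δ / 2 :=
        continuous_snd.continuousAt.eventually_lt continuousAt_const hp
      filter_upwards [this] with q hq
      by_cases hq' : q.2 ≤ 1 / 2
      · simp only [hf, hq', if_true, Function.comp]
      · simp only [hf, hq', if_false, Function.comp]
        rw [h3 _ _ (by linarith), k2 _ _ (by linarith)]
    · right
      have : ∀ᶠ q : ℝ × ℝ in 𝓝 p, 1 / 2 < q.2 :=
        continuousAt_const.eventually_lt continuous_snd.continuousAt (by linarith)
      filter_upwards [this] with q hq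
      simp only [hf, not_le.2 hq, if_false, Function.comp]
  refine ⟨f, ?_, ⟨min ε δ / 2, by positivity, by linarith, ?_, ?_, ?_, ?_⟩, ?_⟩
  · refine contMDiff_of_eventuallyEq fun p ↦ ?_
    rcases key p with e | e
    · exact ⟨_, hs.comp hφ.contMDiff, e⟩
    · exact ⟨_, ks.comp hψ.contMDiff, e⟩
  · intro s t ht
    simp only [hf]
    rw [if_pos (by linarith)]
    exact h2 _ _ (by linarith)
  · intro s t ht
    simp only [hf]
    rw [if_neg (by linarith)]
    exact k3 _ _ (by linarith)
  · intro s t hs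
    simp only [hf, SPath.concat]
    rw [h4 _ _ (by linarith), k4 _ _ (by linarith)]
  · intro s t hs
    simp only [hf, SPath.concat]
    rw [h5 _ _ (by linarith), k5 _ _ (by linarith)]
  · refine rankLEOne_of_eventuallyEq fun p ↦ ?_
    rcases key p with e | e
    · exact ⟨_, hr.precomp hs hφ, e⟩
    · exact ⟨_, kr.precomp ks hψ, e⟩

/-- A smooth step function: `0` up to `1/3`, `1` from `2/3` on. -/
noncomputable def step (t : ℝ) : ℝ := Real.smoothTransition (3 * t - 1)

theorem step_contDiff : ContDiff ℝ ∞ step :=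
  Real.smoothTransition.contDiff.comp (by fun_prop)

theorem step_zero {t : ℝ} (h : t ≤ 1 / 3) : step t = 0 :=
  Real.smoothTransition.zero_of_nonpos (by linarith)

theorem step_one {t : ℝ} (h : 2 / 3 ≤ t) : step t = 1 :=
  Real.smoothTransition.one_of_one_le (by linarith)

theorem step_nonneg (t : ℝ) : 0 ≤ step t := Real.smoothTransition.nonneg _

theorem step_le_one (t : ℝ) : step t ≤ 1 := Real.smoothTransition.le_one _

/-- Two reparametrizations of the same smooth curve are thin homotopic. -/
theorem thinHomotopic_of_curve {Γ : ℝ → X} (hΓ : ContMDiff 𝓘(ℝ, ℝ) I ∞ (ι ∘ Γ))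
    {a b : ℝ → ℝ} (ha : ContDiff ℝ ∞ a) (hb : ContDiff ℝ ∞ b) (γ₁ γ₂ : SPath I ι x y)
    (h₁ : ∀ t, γ₁.toFun t = Γ (a t)) (h₂ : ∀ t, γ₂.toFun t = Γ (b t)) {ε : ℝ} (hε : 0 < ε)
    (hx : ∀ r t, 0 ≤ r → r ≤ 1 → t < ε → Γ ((1 - r) * a t + r * b t) = x)
    (hy : ∀ r t, 0 ≤ r → r ≤ 1 → 1 - ε < t → Γ ((1 - r) * a t + r * b t) = y) :
    γ₁.ThinHomotopic γ₂ := by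
  have hA : ContDiff ℝ ∞ (fun p : ℝ × ℝ ↦ (1 - step p.1) * a p.2 + step p.1 * b p.2) := by
    have := step_contDiff
    fun_prop
  have m1 := min_le_left ε (1 / 3)
  have m2 := min_le_right ε (1 / 3)
  have m3 : 0 < min ε (1 / 3) := lt_min hε (by norm_num)
  refine ⟨Γ ∘ fun p : ℝ × ℝ ↦ (1 - step p.1) * a p.2 + step p.1 * b p.2,
    hΓ.comp hA.contMDiff, ⟨min ε (1 / 3), m3, by linarith, ?_, ?_, ?_, ?_⟩,
    rankLEOne_of_curve hΓ hA⟩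
  · exact fun s t ht ↦ hx _ _ (step_nonneg _) (step_le_one _) (by linarith)
  · exact fun s t ht ↦ hy _ _ (step_nonneg _) (step_le_one _) (by linarith)
  · intro s t hs
    simp [step_zero (t := s) (by linarith), h₁]
  · intro s t hs
    simp [step_one (t := s) (by linarith), h₂]

/-- The path run through by means of the step function. -/
noncomputable def slow (γ : SPath I ι x y) : SPath I ι x y where
  toFun := fun t ↦ γ.toFun (step t)
  smooth := γ.smooth.comp step_contDiff.contMDiff
  sitting := by
    obtain ⟨ε, h0, h1, h2, h3⟩ := γ.sitting
    refine ⟨1 / 3, by norm_num, by norm_num, fun t ht ↦ ?_, fun t ht ↦ ?_⟩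
    · rw [step_zero ht.le]; exact h2 _ h0
    · rw [step_one (by linarith)]; exact h3 _ (by linarith)

theorem apply_zero (γ : SPath I ι x y) : γ.toFun 0 = x := by
  obtain ⟨ε, h0, h1, h2, h3⟩ := γ.sitting
  exact h2 _ h0

theorem apply_one (γ : SPath I ι x y) : γ.toFun 1 = y := by
  obtain ⟨ε, h0, h1, h2, h3⟩ := γ.sitting
  exact h3 _ (by linarith)

theorem thinHomotopic_slow (γ : SPath I ι x y) : γ.ThinHomotopic γ.slow := by
  obtain ⟨ε, h0, h1, h2, h3⟩ := γ.sitting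
  have m1 := min_le_left ε (1 / 3)
  have m2 := min_le_right ε (1 / 3)
  refine thinHomotopic_of_curve (ε := min ε (1 / 3)) γ.smooth contDiff_id step_contDiff γ γ.slow
    (fun _ ↦ rfl) (fun _ ↦ rfl) (lt_min h0 (by norm_num)) ?_ ?_
  · intro r t r0 r1 ht
    refine h2 _ ?_
    rw [step_zero (by linarith)]
    simp only [id, mul_zero, add_zero]
    by_cases h : 0 ≤ t
    · nlinarith
    · nlinarith
  · intro r t r0 r1 ht
    refine h3 _ ?_
    rw [step_one (by linarith)]
    simp only [id]
    by_cases h : t ≤ 1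
    · nlinarith
    · nlinarith

theorem const_concat (γ : SPath I ι x y) :
    ((const I ι x).concat γ).ThinHomotopic γ := by
  refine ((ThinHomotopic.refl _).concat γ.thinHomotopic_slow).trans
    (ThinHomotopic.trans ?_ γ.thinHomotopic_slow.symm)
  refine thinHomotopic_of_curve (ε := 1 / 6) γ.smooth
    (a := fun t ↦ step (2 * t - 1)) (b := step) (step_contDiff.comp (by fun_prop))
    step_contDiff _ _ ?_ (fun _ ↦ rfl) (by norm_num) ?_ ?_
  · intro t
    simp only [concat, const, slow]
    split_ifs
    · rw [step_zero (by linarith), γ.apply_zero]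
    · rfl
  · intro r t _ _ ht
    simp [step_zero (t := t) (by linarith), step_zero (t := 2 * t - 1) (by linarith), γ.apply_zero]
  · intro r t _ _ ht
    simp [step_one (t := t) (by linarith), step_one (t := 2 * t - 1) (by linarith), γ.apply_one]

theorem concat_const (γ : SPath I ι x y) :
    (γ.concat (const I ι y)).ThinHomotopic γ := by
  refine (γ.thinHomotopic_slow.concat (ThinHomotopic.refl _)).trans
    (ThinHomotopic.trans ?_ γ.thinHomotopic_slow.symm)
  refine thinHomotopic_of_curve (ε := 1 / 6) γ.smooth
    (a := fun t ↦ step (2 * t)) (b := step) (step_contDiff.comp (by fun_prop))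
    step_contDiff _ _ ?_ (fun _ ↦ rfl) (by norm_num) ?_ ?_
  · intro t
    simp only [concat, const, slow]
    split_ifs
    · rfl
    · rw [step_one (by linarith), γ.apply_one]
  · intro r t _ _ ht
    simp [step_zero (t := t) (by linarith), step_zero (t := 2 * t) (by linarith), γ.apply_zero]
  · intro r t _ _ ht
    simp [step_one (t := t) (by linarith), step_one (t := 2 * t) (by linarith), γ.apply_one]

theorem concat_reverse (γ : SPath I ι x y) :
    (γ.concat γ.reverse).ThinHomotopic (const I ι x) := by
  refine (γ.thinHomotopic_slow.concat γ.thinHomotopic_slow.reverse).trans ?_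
  refine thinHomotopic_of_curve (ε := 1 / 6) γ.smooth
    (a := fun t ↦ step (2 * t) * step (2 - 2 * t)) (b := fun _ ↦ 0)
    ((step_contDiff.comp (by fun_prop)).mul (step_contDiff.comp (by fun_prop)))
    contDiff_const _ _ ?_ (fun _ ↦ γ.apply_zero.symm) (by norm_num) ?_ ?_
  · intro t
    simp only [concat, reverse, slow]
    split_ifs
    · rw [step_one (t := 2 - 2 * t) (by linarith), mul_one]
    · rw [step_one (t := 2 * t) (by linarith), one_mul]
      ring_nf
  · intro r t _ _ ht
    simp [step_zero (t := 2 * t) (by linarith), γ.apply_zero]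
  · intro r t _ _ ht
    simp [step_zero (t := 2 - 2 * t) (by linarith), γ.apply_zero]

theorem reverse_reverse (γ : SPath I ι x y) : γ.reverse.reverse = γ := by
  cases γ
  simp [reverse]

theorem reverse_concat (γ : SPath I ι x y) :
    (γ.reverse.concat γ).ThinHomotopic (const I ι y) := by
  have := γ.reverse.concat_reverse
  rwa [reverse_reverse] at this

theorem concat_assoc {w : X} (γ₁ : SPath I ι x y) (γ₂ : SPath I ι y z) (γ₃ : SPath I ι z w) :
    ((γ₁.concat γ₂).concat γ₃).ThinHomotopic (γ₁.concat (γ₂.concat γ₃)) := by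
  have s₁ := γ₁.thinHomotopic_slow
  have s₂ := γ₂.thinHomotopic_slow
  have s₃ := γ₃.thinHomotopic_slow
  refine ((s₁.concat s₂).concat s₃).trans
    (ThinHomotopic.trans ?_ (s₁.concat (s₂.concat s₃)).symm)
  set Γ : ℝ → X := fun t ↦ if t ≤ 1 then γ₁.toFun t else
    (if t ≤ 2 then γ₂.toFun (t - 1) else γ₃.toFun (t - 2)) with hΓ
  have hs : ContMDiff 𝓘(ℝ, ℝ) I ∞ (ι ∘ Γ) := by
    obtain ⟨ε₁, h0, h1, h2, h3⟩ := γ₁.sitting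
    obtain ⟨ε₂, k0, k1, k2, k3⟩ := γ₂.sitting
    obtain ⟨ε₃, l0, l1, l2, l3⟩ := γ₃.sitting
    have c₂ := γ₂.smooth.comp (show ContDiff ℝ ∞ (fun t : ℝ ↦ t - 1) by fun_prop).contMDiff
    have c₃ := γ₃.smooth.comp (show ContDiff ℝ ∞ (fun t : ℝ ↦ t - 2) by fun_prop).contMDiff
    have m1 := min_le_left ε₂ ε₃
    have m2 := min_le_right ε₂ ε₃
    have n1 := min_le_left ε₁ ε₂
    have n2 := min_le_right ε₁ ε₂
    refine contMDiff_glue (y := y) (lt_min h0 k0) γ₁.smooth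
      (contMDiff_glue (y := z) (lt_min k0 l0) c₂ c₃ ?_ ?_) ?_ ?_
    · exact fun t ht ↦ k3 _ (by linarith)
    · exact fun t ht ↦ l2 _ (by linarith)
    · exact fun t ht ↦ h3 _ (by linarith)
    · intro t ht
      rw [if_pos (by linarith)]
      exact k2 _ (by linarith)
  have G1 : ∀ t, t ≤ 1 → Γ t = γ₁.toFun t := fun t ht ↦ by simp only [hΓ, if_pos ht]
  have G2 : ∀ t, 0 ≤ t → t ≤ 1 → Γ (1 + t) = γ₂.toFun t := by
    intro t ht ht'
    rcases ht.eq_or_lt with rfl | h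
    · rw [γ₂.apply_zero, G1 _ (by simp), add_zero, γ₁.apply_one]
    · simp only [hΓ]
      rw [if_neg (by linarith), if_pos (by linarith)]
      simp
  have G3 : ∀ t, 0 ≤ t → Γ (2 + t) = γ₃.toFun t := by
    intro t ht
    rcases ht.eq_or_lt with rfl | h
    · rw [γ₃.apply_zero, add_zero, show (2 : ℝ) = 1 + 1 by norm_num, G2 _ (by simp) le_rfl,
        γ₂.apply_one]
    · simp only [hΓ]
      rw [if_neg (by linarith), if_neg (by linarith)]
      simp
  have hst (l : ℝ → ℝ) (hl : ContDiff ℝ ∞ l) : ContDiff ℝ ∞ (fun t ↦ step (l t)) :=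
    step_contDiff.comp hl
  refine thinHomotopic_of_curve (ε := 1 / 12) hs
    (a := fun t ↦ step (4 * t) + step (4 * t - 1) + step (2 * t - 1))
    (b := fun t ↦ step (2 * t) + step (4 * t - 2) + step (4 * t - 3))
    (((hst _ (by fun_prop)).add (hst _ (by fun_prop))).add (hst _ (by fun_prop)))
    (((hst _ (by fun_prop)).add (hst _ (by fun_prop))).add (hst _ (by fun_prop)))
    _ _ ?_ ?_ (by norm_num) ?_ ?_
  · intro t
    simp only [concat, slow]
    split_ifs with h h'
    · rw [step_zero (t := 4 * t - 1) (by linarith), step_zero (t := 2 * t - 1) (by linarith),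
        add_zero, add_zero, G1 _ (step_le_one _)]
      ring_nf
    · rw [step_one (t := 4 * t) (by linarith), step_zero (t := 2 * t - 1) (by linarith),
        add_zero, G2 _ (step_nonneg _) (step_le_one _)]
      ring_nf
    · rw [step_one (t := 4 * t) (by linarith), step_one (t := 4 * t - 1) (by linarith),
        one_add_one_eq_two, G3 _ (step_nonneg _)]
  · intro t
    simp only [concat, slow]
    split_ifs with h h'
    · rw [step_zero (t := 4 * t - 2) (by linarith), step_zero (t := 4 * t - 3) (by linarith),
        add_zero, add_zero, G1 _ (step_le_one _)]
    · rw [step_one (t := 2 * t) (by linarith), step_zero (t := 4 * t - 3) (by linarith),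
        add_zero, G2 _ (step_nonneg _) (step_le_one _)]
      ring_nf
    · rw [step_one (t := 2 * t) (by linarith), step_one (t := 4 * t - 2) (by linarith),
        one_add_one_eq_two, G3 _ (step_nonneg _)]
      ring_nf
  · intro r t _ _ ht
    rw [step_zero (t := 4 * t) (by linarith), step_zero (t := 4 * t - 1) (by linarith),
      step_zero (t := 2 * t - 1) (by linarith), step_zero (t := 2 * t) (by linarith),
      step_zero (t := 4 * t - 2) (by linarith), step_zero (t := 4 * t - 3) (by linarith)]
    simp [G1, γ₁.apply_zero]
  · intro r t _ _ ht
    rw [step_one (t := 4 * t) (by linarith), step_one (t := 4 * t - 1) (by linarith),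
      step_one (t := 2 * t - 1) (by linarith), step_one (t := 2 * t) (by linarith),
      step_one (t := 4 * t - 2) (by linarith), step_one (t := 4 * t - 3) (by linarith)]
    rw [show (1 - r) * (1 + 1 + 1) + r * (1 + 1 + 1) = 2 + (1 : ℝ) by ring, G3 _ (by simp),
      γ₃.apply_one]

end SPath

/-- The objects of the path groupoid of `X` are the points of `X`. -/
@[ext]
structure PathGroupoid (I : ModelWithCorners ℝ E H) (ι : X → N) where
  pt : X

/-- The path groupoid: the morphisms are the thin homotopy classes of paths, composed by
concatenation. -/
noncomputable instance PathGroupoid.groupoid (I : ModelWithCorners ℝ E H) (ι : X → N) :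
    Groupoid (PathGroupoid I ι) where
  Hom x y := Quotient (SPath.thinSetoid I ι x.pt y.pt)
  id x := Quotient.mk _ (SPath.const I ι x.pt)
  comp := Quotient.map₂ SPath.concat fun _ _ h _ _ k ↦ h.concat k
  id_comp := by
    rintro x y ⟨γ⟩
    exact Quotient.sound γ.const_concat
  comp_id := by
    rintro x y ⟨γ⟩
    exact Quotient.sound γ.concat_const
  assoc := by
    rintro x y z w ⟨γ₁⟩ ⟨γ₂⟩ ⟨γ₃⟩
    exact Quotient.sound (γ₁.concat_assoc γ₂ γ₃)
  inv := Quotient.map SPath.reverse fun _ _ h ↦ h.reverse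
  inv_comp := by
    rintro x y ⟨γ⟩
    exact Quotient.sound γ.reverse_concat
  comp_inv := by
    rintro x y ⟨γ⟩
    exact Quotient.sound γ.concat_reverse

/-- The thin homotopy class of a path, as a morphism of the path groupoid. -/
def SPath.cls {x y : X} (γ : SPath I ι x y) :
    (⟨x⟩ : PathGroupoid I ι) ⟶ (⟨y⟩ : PathGroupoid I ι) :=
  Quotient.mk _ γ

variable {E' H' N' X' E'' H'' N₂ X'' : Type*}
  [NormedAddCommGroup E'] [NormedSpace ℝ E'] [TopologicalSpace H']
  [TopologicalSpace N'] [ChartedSpace H' N']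
  [NormedAddCommGroup E''] [NormedSpace ℝ E''] [TopologicalSpace H'']
  [TopologicalSpace N₂] [ChartedSpace H'' N₂]
  {I' : ModelWithCorners ℝ E' H'} {ι' : X' → N'} {I'' : ModelWithCorners ℝ E'' H''}
  {ι'' : X'' → N₂}

/-- The map `f : X → X'` is the restriction of a smooth map of the ambient manifolds. -/
def RestrictsSmooth (I : ModelWithCorners ℝ E H) (ι : X → N) (I' : ModelWithCorners ℝ E' H')
    (ι' : X' → N') (f : X → X') : Prop :=
  ∃ F : N → N', ContMDiff I I' ∞ F ∧ ∀ x, ι' (f x) = F (ι x)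

/-- The image of a path under a smooth map. -/
def SPath.map {f : X → X'} (hf : RestrictsSmooth I ι I' ι' f) {x y : X} (γ : SPath I ι x y) :
    SPath I' ι' (f x) (f y) where
  toFun := fun t ↦ f (γ.toFun t)
  smooth := by
    obtain ⟨F, hF, h⟩ := hf
    have : (ι' ∘ fun t ↦ f (γ.toFun t)) = F ∘ (ι ∘ γ.toFun) := funext fun t ↦ h _
    rw [this]
    exact hF.comp γ.smooth
  sitting := by
    obtain ⟨ε, h0, h1, h2, h3⟩ := γ.sitting
    exact ⟨ε, h0, h1, fun t ht ↦ by rw [h2 t ht], fun t ht ↦ by rw [h3 t ht]⟩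

theorem SPath.ThinHomotopic.map {f : X → X'} (hf : RestrictsSmooth I ι I' ι' f) {x y : X}
    {γ₁ γ₂ : SPath I ι x y} (h : γ₁.ThinHomotopic γ₂) :
    (γ₁.map hf).ThinHomotopic (γ₂.map hf) := by
  obtain ⟨h, hs, ⟨ε, h0, h1, h2, h3, h4, h5⟩, hr⟩ := h
  obtain ⟨F, hF, hFe⟩ := hf
  have e : (ι' ∘ f ∘ h) = F ∘ (ι ∘ h) := funext fun p ↦ hFe _
  refine ⟨f ∘ h, ?_, ⟨ε, h0, h1, ?_, ?_, ?_, ?_⟩, ?_⟩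
  · rw [e]
    exact hF.comp hs
  · exact fun s t ht ↦ congrArg f (h2 s t ht)
  · exact fun s t ht ↦ congrArg f (h3 s t ht)
  · exact fun s t ht ↦ congrArg f (h4 s t ht)
  · exact fun s t ht ↦ congrArg f (h5 s t ht)
  · intro p
    have h1 : MDifferentiableAt 𝓘(ℝ, ℝ × ℝ) I (ι ∘ h) p := hs.mdifferentiable (by simp) _
    have h2 : MDifferentiableAt I I' F ((ι ∘ h) p) := hF.mdifferentiable (by simp) _
    have h3 : (mfderiv 𝓘(ℝ, ℝ × ℝ) I' (F ∘ (ι ∘ h)) p : (ℝ × ℝ) →L[ℝ] E') =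
        (mfderiv I I' F ((ι ∘ h) p) : E →L[ℝ] E').comp
          (mfderiv 𝓘(ℝ, ℝ × ℝ) I (ι ∘ h) p : (ℝ × ℝ) →L[ℝ] E) := mfderiv_comp p h2 h1
    rw [e, h3]
    have h4 := LinearMap.lift_rank_comp_le_right
      (mfderiv 𝓘(ℝ, ℝ × ℝ) I (ι ∘ h) p : (ℝ × ℝ) →L[ℝ] E).toLinearMap
      (mfderiv I I' F ((ι ∘ h) p) : E →L[ℝ] E').toLinearMap
    have h5 := h4.trans (Cardinal.lift_le_one_iff.2 (hr p))
    exact Cardinal.lift_le_one_iff.1 h5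

/-- The functor of path groupoids induced by a smooth map: `x ↦ f x` and `[γ] ↦ [f ∘ γ]`. -/
noncomputable def pushforward {f : X → X'} (hf : RestrictsSmooth I ι I' ι' f) :
    PathGroupoid I ι ⥤ PathGroupoid I' ι' where
  obj x := ⟨f x.pt⟩
  map := Quotient.map (SPath.map hf) fun _ _ h ↦ h.map hf
  map_id _ := rfl
  map_comp := by
    rintro x y z ⟨γ₁⟩ ⟨γ₂⟩
    refine congrArg (Quotient.mk _) ?_
    simp only [SPath.map, SPath.concat, apply_ite f]

theorem RestrictsSmooth.comp {f : X → X'} {g : X' → X''} (hg : RestrictsSmooth I' ι' I'' ι'' g)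
    (hf : RestrictsSmooth I ι I' ι' f) : RestrictsSmooth I ι I'' ι'' (g ∘ f) := by
  obtain ⟨F, hF, h⟩ := hf
  obtain ⟨G, hG, k⟩ := hg
  exact ⟨G ∘ F, hG.comp hF, fun x ↦ by simp [h, k]⟩

theorem pushforward_comp {f : X → X'} {g : X' → X''} (hg : RestrictsSmooth I' ι' I'' ι'' g)
    (hf : RestrictsSmooth I ι I' ι' f) :
    pushforward hf ⋙ pushforward hg = pushforward (hg.comp hf) := by
  refine CategoryTheory.Functor.hext (fun _ ↦ rfl) ?_
  rintro x y ⟨γ⟩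
  exact heq_of_eq rfl

theorem pushforward_congr {f g : X → X'} (hf : RestrictsSmooth I ι I' ι' f)
    (hg : RestrictsSmooth I ι I' ι' g) (h : f = g) : pushforward hf = pushforward hg := by
  subst h
  rfl

/-- The set of all paths in `X`, with arbitrary end points. -/
structure PathSpace (I : ModelWithCorners ℝ E H) (ι : X → N) where
  src : X
  tgt : X
  path : SPath I ι src tgt

end Paths

/-- A smooth manifold whose connected components may have different dimensions: for each `n` an
`n`-dimensional part (possibly empty), which is a smooth manifold modelled on `ℝⁿ`, the whole being
the disjoint union of these parts. Such manifolds occur as spaces of objects and morphisms of Lie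
groupoids, for instance for the disjoint union over `n` of the one-object groupoids of the unitary
groups `U(n)`. -/
class MixedManifold (Z : Type w) where
  part : ℕ → Type w
  [top : ∀ n, TopologicalSpace (part n)]
  [charted : ∀ n, ChartedSpace (EuclideanSpace ℝ (Fin n)) (part n)]
  [mfd : ∀ n, IsManifold (𝓡 n) ∞ (part n)]
  equiv : (Σ n, part n) ≃ Z

attribute [reducible, instance] MixedManifold.top MixedManifold.charted
attribute [instance] MixedManifold.mfd

namespace MixedManifold

/-- The inclusion of the `n`-dimensional part. -/
def incl (Z : Type w) [MixedManifold Z] (n : ℕ) (z : part Z n) : Z := equiv ⟨n, z⟩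

end MixedManifold

open MixedManifold

section Smooth

variable {E H N X : Type*} [NormedAddCommGroup E] [NormedSpace ℝ E] [TopologicalSpace H]
  [TopologicalSpace N] [ChartedSpace H N] {Z : Type w} [MixedManifold Z]

/-- Smoothness of a map `f : X → Z` into a manifold with components of possibly different dimensions:
near each point of `X` the map `f` takes values in one of the parts of `Z` and is smooth as a map into
this part. (`ContMDiffWithinAt _ _ _ F (range ι)` is smoothness along the subset `X` of `N`.) -/
def SmoothMap (I : ModelWithCorners ℝ E H) (ι : X → N) (f : X → Z) : Prop :=
  ∀ x : X, ∃ (n : ℕ) (F : N → part Z n),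
    ContMDiffWithinAt I (𝓡 n) ∞ F (range ι) (ι x) ∧
    ∀ᶠ x₂ in Filter.comap ι (𝓝 (ι x)), f x₂ = incl Z n (F (ι x₂))

/-- A submersion between manifolds with components of possibly different dimensions. -/
def MixedSubmersion {Z : Type u} {W : Type w} [MixedManifold Z] [MixedManifold W]
    (f : Z → W) : Prop :=
  ∀ (n : ℕ) (z : part Z n), ∃ (k : ℕ) (F : part Z n → part W k),
    Manifold.IsSubmersionAt (𝓡 n) (𝓡 k) ∞ F z ∧
    ∀ᶠ z' in 𝓝 z, f (incl Z n z') = incl W k (F z')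

end Smooth

/-- The set of all morphisms of a category. -/
structure Mor (G : Type u) [Category.{v} G] where
  src : G
  tgt : G
  hom : src ⟶ tgt

/-- Composition of composable elements of `Mor G`: first `a`, then `b`. -/
def Mor.comp {G : Type u} [Category.{v} G] (a b : Mor G) (h : a.tgt = b.src) : Mor G :=
  ⟨a.src, b.tgt, a.hom ≫ eqToHom h ≫ b.hom⟩

/-- Lie groupoids: a groupoid whose sets of objects and of morphisms are smooth manifolds, such that
source and target are submersions (their surjectivity is clear because of the identity morphisms) and
composition, defined on the submanifold of composable pairs, and the identity map are smooth. -/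
structure LieGroupoid where
  Obj : Type u
  [grpd : Groupoid.{v} Obj]
  [mfdObj : MixedManifold Obj]
  [mfdMor : MixedManifold (Mor Obj)]
  submersion_src : MixedSubmersion (Mor.src : Mor Obj → Obj)
  submersion_tgt : MixedSubmersion (Mor.tgt : Mor Obj → Obj)
  smooth_comp : ∀ n k : ℕ, SmoothMap ((𝓡 n).prod (𝓡 k))
    (Subtype.val : {q : part (Mor Obj) n × part (Mor Obj) k //
      (incl _ n q.1).tgt = (incl _ k q.2).src} → _)
    (fun q ↦ Mor.comp _ _ q.2)
  smooth_id : ∀ n : ℕ, SmoothMap (𝓡 n) (id : part Obj n → part Obj n)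
    (fun x ↦ (⟨_, _, 𝟙 (incl Obj n x)⟩ : Mor Obj))

attribute [instance] LieGroupoid.grpd LieGroupoid.mfdObj LieGroupoid.mfdMor

section SmoothFunctor

variable {E H N X : Type*} [NormedAddCommGroup E] [NormedSpace ℝ E] [TopologicalSpace H]
  [TopologicalSpace N] [ChartedSpace H N] {I : ModelWithCorners ℝ E H} {ι : X → N}
  {Gr : LieGroupoid.{u, v}}

/-- Smooth functors from the path groupoid of `X` to a Lie groupoid: smooth on objects, and for every
open `U ⊆ ℝᵏ` and every family `c : U → PX` of paths such that `(u, t) ↦ c u t` is smooth on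
`U × [0,1]`, the map `u ↦ F [c u]` is smooth. (Only the values of `c` on `U` are used.) -/
structure SmoothFunctor (F : PathGroupoid I ι ⥤ Gr.Obj) : Prop where
  obj : SmoothMap I ι (fun x ↦ F.obj ⟨x⟩)
  map : ∀ (k : ℕ) (U : Set (EuclideanSpace ℝ (Fin k))), IsOpen U →
    ∀ c : EuclideanSpace ℝ (Fin k) → PathSpace I ι,
      ContMDiffOn 𝓘(ℝ, EuclideanSpace ℝ (Fin k) × ℝ) I ∞
        (fun p ↦ ι ((c p.1).path.toFun p.2)) (U ×ˢ Icc 0 1) →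
      SmoothMap 𝓘(ℝ, EuclideanSpace ℝ (Fin k)) (Subtype.val : U → EuclideanSpace ℝ (Fin k))
        (fun u ↦ (⟨_, _, F.map (c u).path.cls⟩ : Mor Gr.Obj))

/-- Smooth natural transformations: the components form a smooth map `X → Mor Gr`. -/
def SmoothNatTrans {F G : PathGroupoid I ι ⥤ Gr.Obj} (η : F ⟶ G) : Prop :=
  SmoothMap I ι (fun x ↦ (⟨_, _, η.app ⟨x⟩⟩ : Mor Gr.Obj))

/-- Post-composition of a smooth map with a map that is smooth on each part. -/
theorem SmoothMap.comp_mixed {Z W : Type*} [MixedManifold Z] [MixedManifold W] {f : X → Z}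
    (hf : SmoothMap I ι f) {φ : Z → W}
    (hφ : ∀ n, SmoothMap (𝓡 n) (id : part Z n → part Z n) (fun z ↦ φ (incl Z n z))) :
    SmoothMap I ι (fun x ↦ φ (f x)) := by
  intro x
  obtain ⟨n, F, hF, e⟩ := hf x
  obtain ⟨k, G, hG, e'⟩ := hφ n (F (ι x))
  refine ⟨k, G ∘ F, ?_, ?_⟩
  · exact ContMDiffWithinAt.comp (ι x) hG hF (fun _ _ ↦ by simp)
  · have hc : Filter.Tendsto (fun x' ↦ F (ι x')) (Filter.comap ι (𝓝 (ι x))) (𝓝 (F (ι x))) := by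
      refine hF.continuousWithinAt.tendsto.comp ?_
      exact tendsto_nhdsWithin_iff.2 ⟨Filter.tendsto_comap, by simp⟩
    rw [Filter.comap_id] at e'
    filter_upwards [e, hc.eventually e'] with x' h1 h2
    rw [h1]
    exact h2

/-- Pointwise composites of smooth families of composable arrows are smooth. -/
theorem SmoothMap.mor_comp {a b : X → Mor Gr.Obj} (ha : SmoothMap I ι a) (hb : SmoothMap I ι b)
    (h : ∀ x, (a x).tgt = (b x).src) : SmoothMap I ι (fun x ↦ Mor.comp (a x) (b x) (h x)) := by
  intro x
  obtain ⟨n, A, hA, ea⟩ := ha x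
  obtain ⟨k, B, hB, eb⟩ := hb x
  have key : ∀ x', a x' = incl _ n (A (ι x')) → b x' = incl _ k (B (ι x')) →
      (incl (Mor Gr.Obj) n (A (ι x'))).tgt = (incl (Mor Gr.Obj) k (B (ι x'))).src := by
    intro x' h1 h2
    rw [← h1, ← h2]
    exact h x'
  have hx : ∀ᶠ x' in Filter.comap ι (𝓝 (ι x)),
      a x' = incl _ n (A (ι x')) ∧ b x' = incl _ k (B (ι x')) := ea.and eb
  have h0 : a x = incl _ n (A (ι x)) ∧ b x = incl _ k (B (ι x)) := by
    obtain ⟨s, hs, hs'⟩ := Filter.mem_comap.1 hx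
    have h1 : ι x ∈ s := mem_of_mem_nhds hs
    exact hs' h1
  obtain ⟨l, C, hC, ec⟩ := Gr.smooth_comp n k ⟨(A (ι x), B (ι x)), key x h0.1 h0.2⟩
  have hAB : ContMDiffWithinAt I ((𝓡 n).prod (𝓡 k)) ∞ (fun p ↦ (A p, B p)) (range ι) (ι x) :=
    hA.prodMk hB
  refine ⟨l, fun p ↦ C (A p, B p), ?_, ?_⟩
  · refine (ContMDiffWithinAt.comp' (ι x) hC hAB).mono_of_mem_nhdsWithin ?_
    obtain ⟨s, hs, hs'⟩ := Filter.mem_comap.1 hx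
    rw [mem_nhdsWithin_iff_exists_mem_nhds_inter]
    refine ⟨s, hs, ?_⟩
    rintro _ ⟨hp, x', rfl⟩
    have := hs' hp
    exact ⟨⟨x', rfl⟩, ⟨_, key x' this.1 this.2⟩, rfl⟩
  · obtain ⟨s, hs, hs'⟩ := Filter.mem_comap.1 ec
    have hc : Filter.Tendsto (fun x' ↦ (A (ι x'), B (ι x'))) (Filter.comap ι (𝓝 (ι x)))
        (𝓝 (A (ι x), B (ι x))) := by
      refine hAB.continuousWithinAt.tendsto.comp ?_
      exact tendsto_nhdsWithin_iff.2 ⟨Filter.tendsto_comap, by simp⟩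
    filter_upwards [hx, hc.eventually hs] with x' h1 h2
    have h3 := hs' (a := ⟨(A (ι x'), B (ι x')), key x' h1.1 h1.2⟩) h2
    refine Eq.trans ?_ h3
    congr 1
    · exact h1.1
    · exact h1.2

theorem SmoothNatTrans.comp {F G K : PathGroupoid I ι ⥤ Gr.Obj} {η : F ⟶ G} {θ : G ⟶ K}
    (hη : SmoothNatTrans η) (hθ : SmoothNatTrans θ) : SmoothNatTrans (η ≫ θ) := by
  have := SmoothMap.mor_comp hη hθ (fun _ ↦ rfl)
  simpa [Mor.comp, SmoothNatTrans] using this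

theorem SmoothNatTrans.id {F : PathGroupoid I ι ⥤ Gr.Obj} (hF : SmoothFunctor F) :
    SmoothNatTrans (𝟙 F) := by
  have := hF.obj.comp_mixed (φ := fun x ↦ (⟨_, _, 𝟙 x⟩ : Mor Gr.Obj)) Gr.smooth_id
  simpa [SmoothNatTrans] using this

end SmoothFunctor

section Descent

/-- A surjective submersion `proj : total → M` from a smooth manifold to `M`. -/
structure SurjSubmersion (m : ℕ) (M : Type u) [TopologicalSpace M]
    [ChartedSpace (EuclideanSpace ℝ (Fin m)) M] where
  total : Type u
  dim : ℕ
  [top : TopologicalSpace total]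
  [charted : ChartedSpace (EuclideanSpace ℝ (Fin dim)) total]
  [mfd : IsManifold (𝓡 dim) ∞ total]
  [t2 : T2Space total]
  [sc : SecondCountableTopology total]
  proj : total → M
  submersion : Manifold.IsSubmersion (𝓡 dim) (𝓡 m) ∞ proj
  surj : Function.Surjective proj

attribute [instance] SurjSubmersion.top SurjSubmersion.charted
attribute [instance] SurjSubmersion.mfd SurjSubmersion.t2 SurjSubmersion.sc

variable {m : ℕ} {M : Type u} [TopologicalSpace M] [ChartedSpace (EuclideanSpace ℝ (Fin m)) M]

/-- The path groupoid of an `m`-dimensional manifold `M`. -/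
abbrev P₁ (m : ℕ) (M : Type u) [TopologicalSpace M] [ChartedSpace (EuclideanSpace ℝ (Fin m)) M] :
    Type u :=
  PathGroupoid (𝓡 m) (id : M → M)

namespace SurjSubmersion

variable (π : SurjSubmersion m M)

/-- A surjective submersion `π : Y → M` is contractible if there is a smooth map
`c : Y × [0,1] → Y` with `c (y, 0) = y` and `c (y, 1) = b k` for all `y` in the connected component
`k` of `Y`, where `b k` is some fixed choice of a point in the component `k`. -/
def IsContractible : Prop :=
  ∃ (c : π.total × ℝ → π.total) (b : ConnectedComponents π.total → π.total),
    ContMDiffOn ((𝓡 π.dim).prod 𝓘(ℝ, ℝ)) (𝓡 π.dim) ∞ c (univ ×ˢ Icc 0 1) ∧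
    (∀ k, (b k : ConnectedComponents π.total) = k) ∧
    (∀ y, c (y, 0) = y) ∧ (∀ y, c (y, 1) = b y)

/-- The fibre product `Y ×_M Y`, an embedded submanifold of `Y × Y`. -/
abbrev Fib₂ : Type u := {q : π.total × π.total // π.proj q.1 = π.proj q.2}

/-- The path groupoid of `Y`. -/
abbrev P₁Total : Type u := P₁ π.dim π.total

/-- The path groupoid of `Y ×_M Y`. -/
abbrev P₁Fib₂ : Type u :=
  PathGroupoid ((𝓡 π.dim).prod (𝓡 π.dim)) (Subtype.val : π.Fib₂ → π.total × π.total)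

theorem restrictsSmooth_proj :
    RestrictsSmooth (𝓡 π.dim) (id : π.total → π.total) (𝓡 m) (id : M → M) π.proj :=
  ⟨π.proj, π.submersion.contMDiff, fun _ ↦ rfl⟩

theorem restrictsSmooth_fst :
    RestrictsSmooth ((𝓡 π.dim).prod (𝓡 π.dim)) (Subtype.val : π.Fib₂ → π.total × π.total)
      (𝓡 π.dim) (id : π.total → π.total) (fun q ↦ q.1.1) :=
  ⟨Prod.fst, contMDiff_fst, fun _ ↦ rfl⟩

theorem restrictsSmooth_snd :
    RestrictsSmooth ((𝓡 π.dim).prod (𝓡 π.dim)) (Subtype.val : π.Fib₂ → π.total × π.total)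
      (𝓡 π.dim) (id : π.total → π.total) (fun q ↦ q.1.2) :=
  ⟨Prod.snd, contMDiff_snd, fun _ ↦ rfl⟩

/-- The functor of path groupoids induced by `π : Y → M`. -/
noncomputable def push : π.P₁Total ⥤ P₁ m M := pushforward π.restrictsSmooth_proj

/-- The functor of path groupoids induced by the first projection `Y ×_M Y → Y`. -/
noncomputable def push₁ : π.P₁Fib₂ ⥤ π.P₁Total := pushforward π.restrictsSmooth_fst

/-- The functor of path groupoids induced by the second projection `Y ×_M Y → Y`. -/
noncomputable def push₂ : π.P₁Fib₂ ⥤ π.P₁Total := pushforward π.restrictsSmooth_snd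

theorem push_obj_eq (q : π.P₁Fib₂) :
    π.push.obj (π.push₁.obj q) = π.push.obj (π.push₂.obj q) :=
  congrArg PathGroupoid.mk q.pt.2

theorem push_eq : π.push₁ ⋙ π.push = π.push₂ ⋙ π.push := by
  simp only [push, push₁, push₂, pushforward_comp]
  exact pushforward_congr _ _ (funext fun q ↦ q.2)

end SurjSubmersion

variable {Gr : LieGroupoid.{u₁, v₁}} {T : Type u₂} [Category.{v₂} T]

/-- A `π`-local `i`-trivialization of `F`: a functor `triv` from the path groupoid of `Y` to `Gr` and
a natural equivalence `t` from the pullback of `F` along `π` to `i ∘ triv`. -/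
structure LocalTrivialization (π : SurjSubmersion m M) (i : Gr.Obj ⥤ T) (F : P₁ m M ⥤ T) where
  triv : π.P₁Total ⥤ Gr.Obj
  t : π.push ⋙ F ≅ triv ⋙ i

/-- Functors on the path groupoid of `M` with a `π`-local `i`-trivialization. -/
structure TrivializedFunctor (π : SurjSubmersion m M) (i : Gr.Obj ⥤ T) where
  F : P₁ m M ⥤ T
  loc : LocalTrivialization π i F

variable {π : SurjSubmersion m M} {i : Gr.Obj ⥤ T}

namespace TrivializedFunctor

/-- Morphisms are the natural transformations of the underlying functors. -/
@[ext]
structure Hom (A B : TrivializedFunctor π i) where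
  α : A.F ⟶ B.F

@[simps]
noncomputable instance : Category (TrivializedFunctor π i) where
  Hom := Hom
  id A := ⟨𝟙 A.F⟩
  comp f g := ⟨f.α ≫ g.α⟩

@[ext]
theorem hom_ext {A B : TrivializedFunctor π i} {f g : A ⟶ B} (h : f.α = g.α) : f = g :=
  Hom.ext h

end TrivializedFunctor

/-- Descent data: a functor `triv` and a natural equivalence `g` over `Y ×_M Y` between the two
pullbacks of `i ∘ triv`, subject to the cocycle condition over `Y ×_M Y ×_M Y`. -/
structure DescentData (π : SurjSubmersion m M) (i : Gr.Obj ⥤ T) where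
  triv : π.P₁Total ⥤ Gr.Obj
  g : π.push₁ ⋙ triv ⋙ i ≅ π.push₂ ⋙ triv ⋙ i
  cocycle : ∀ (y₁ y₂ y₃ : π.total) (h₁₂ : π.proj y₁ = π.proj y₂) (h₂₃ : π.proj y₂ = π.proj y₃),
    g.hom.app ⟨⟨(y₁, y₂), h₁₂⟩⟩ ≫ g.hom.app ⟨⟨(y₂, y₃), h₂₃⟩⟩ =
      g.hom.app ⟨⟨(y₁, y₃), h₁₂.trans h₂₃⟩⟩

namespace DescentData

/-- Morphisms of descent data: natural transformations compatible with `g`. -/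
@[ext]
structure Hom (A B : DescentData π i) where
  h : A.triv ⋙ i ⟶ B.triv ⋙ i
  comm : A.g.hom ≫ Functor.whiskerLeft π.push₂ h = Functor.whiskerLeft π.push₁ h ≫ B.g.hom

@[simps]
noncomputable instance : Category (DescentData π i) where
  Hom := Hom
  id A := ⟨𝟙 _, by simp⟩
  comp f g := ⟨f.h ≫ g.h, by
    rw [Functor.whiskerLeft_comp, Functor.whiskerLeft_comp, ← Category.assoc, f.comm,
      Category.assoc, g.comm, Category.assoc]⟩

@[ext]
theorem hom_ext {A B : DescentData π i} {f g : A ⟶ B} (h : f.h = g.h) : f = g :=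
  Hom.ext h

/-- Smooth descent data: `triv` is smooth and `g` factors through `i` by a smooth natural
equivalence. -/
structure IsSmooth (D : DescentData π i) : Prop where
  triv : SmoothFunctor D.triv
  g : ∃ g' : π.push₁ ⋙ D.triv ≅ π.push₂ ⋙ D.triv,
    (∀ q, D.g.hom.app q = i.map (g'.hom.app q)) ∧ SmoothNatTrans g'.hom

/-- A morphism (between smooth descent data) is smooth if it factors through `i` by a smooth natural
equivalence. -/
def IsSmoothHom {A B : DescentData π i} (f : A ⟶ B) : Prop :=
  ∃ h' : A.triv ≅ B.triv, (∀ y, f.h.app y = i.map (h'.hom.app y)) ∧ SmoothNatTrans h'.hom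

end DescentData

/-- The natural equivalence `g` of a trivialization, with components `t(y') ∘ t(y)⁻¹` at `(y, y')`. -/
noncomputable def LocalTrivialization.transition {F : P₁ m M ⥤ T}
    (L : LocalTrivialization π i F) : π.push₁ ⋙ L.triv ⋙ i ≅ π.push₂ ⋙ L.triv ⋙ i :=
  (Functor.isoWhiskerLeft π.push₁ L.t.symm ≪≫
    Functor.isoWhiskerRight (eqToIso π.push_eq) F) ≪≫ Functor.isoWhiskerLeft π.push₂ L.t

theorem LocalTrivialization.transition_app {F : P₁ m M ⥤ T} (L : LocalTrivialization π i F)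
    (q : π.P₁Fib₂) :
    L.transition.hom.app q = L.t.inv.app (π.push₁.obj q) ≫
      F.map (eqToHom (π.push_obj_eq q)) ≫ L.t.hom.app (π.push₂.obj q) := by
  simp only [transition, Iso.trans_hom, Functor.isoWhiskerLeft_hom, Functor.isoWhiskerRight_hom,
    NatTrans.comp_app, Functor.whiskerLeft_app, Functor.whiskerRight_app, eqToIso.hom,
    eqToHom_app, Iso.symm_hom, Category.assoc]

theorem cocycle_aux {a₁ a₂ a₃ b₁ b₂ b₃ : T} (p : b₁ ⟶ a₁) (f : a₁ ⟶ a₂) (e : a₂ ≅ b₂)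
    (f' : a₂ ⟶ a₃) (f'' : a₁ ⟶ a₃) (hf : f ≫ f' = f'') (q : a₃ ⟶ b₃) :
    (p ≫ f ≫ e.hom) ≫ (e.inv ≫ f' ≫ q) = p ≫ f'' ≫ q := by
  subst hf
  simp

/-- The functor that extracts descent data: an object `(F, triv, t)` goes to `(triv, g)`, a natural
transformation `α` to the natural transformation with components `t'(y) ∘ α(π y) ∘ t(y)⁻¹`. -/
noncomputable def extract (π : SurjSubmersion m M) (i : Gr.Obj ⥤ T) :
    TrivializedFunctor π i ⥤ DescentData π i where
  obj A :=
    { triv := A.loc.triv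
      g := A.loc.transition
      cocycle := by
        intro y₁ y₂ y₃ h₁₂ h₂₃
        simp only [LocalTrivialization.transition_app]
        refine cocycle_aux _ _ (A.loc.t.app ⟨y₂⟩) _ _ ?_ _
        exact (A.F.map_comp _ _).symm.trans (congrArg _ (eqToHom_trans _ _)) }
  map {A B} f :=
    { h := A.loc.t.inv ≫ Functor.whiskerLeft π.push f.α ≫ B.loc.t.hom
      comm := by
        ext q
        simp only [NatTrans.comp_app, Functor.whiskerLeft_app, Category.assoc,
          LocalTrivialization.transition_app, Iso.hom_inv_id_app_assoc]
        rw [f.α.naturality_assoc] }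
  map_id A := by
    ext
    simp
  map_comp f g := by
    ext
    simp

/-- Transport functors with `Gr`-structure: functors on the path groupoid of `M` that admit a
local `i`-trivialization with smooth descent data over some surjective submersion. -/
def IsTransport (i : Gr.Obj ⥤ T) : ObjectProperty (P₁ m M ⥤ T) := fun F ↦
  ∃ (π : SurjSubmersion m M) (L : LocalTrivialization π i F),
    ((extract π i).obj ⟨F, L⟩).IsSmooth

/-- The full subcategory of all functors that consists of the transport functors. -/
abbrev TransportFunctor (m : ℕ) (M : Type u) [TopologicalSpace M]
    [ChartedSpace (EuclideanSpace ℝ (Fin m)) M] (i : Gr.Obj ⥤ T) :=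
  (IsTransport i : ObjectProperty (P₁ m M ⥤ T)).FullSubcategory

/-- Morphisms of transport functors: natural equivalences `η` such that for some surjective
submersion there are trivializations of both functors, with smooth descent data, for which the
descent datum of `η` is smooth. -/
def IsTransportHom (m : ℕ) (M : Type u) [TopologicalSpace M]
    [ChartedSpace (EuclideanSpace ℝ (Fin m)) M] (i : Gr.Obj ⥤ T) :
    MorphismProperty (TransportFunctor m M i) := fun F F' η ↦
  IsIso η.hom ∧ ∃ (π : SurjSubmersion m M) (L : LocalTrivialization π i F.obj)
    (L₂ : LocalTrivialization π i F'.obj),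
    ((extract π i).obj ⟨F.obj, L⟩).IsSmooth ∧ ((extract π i).obj ⟨F'.obj, L₂⟩).IsSmooth ∧
    DescentData.IsSmoothHom ((extract π i).map (⟨η.hom⟩ :
      (⟨F.obj, L⟩ : TrivializedFunctor π i) ⟶ ⟨F'.obj, L₂⟩))

/-- The category of transport functors and morphisms of transport functors. It is a category as soon
as identities and composites of morphisms of transport functors are again such morphisms. -/
abbrev TransportCat (m : ℕ) (M : Type u) [TopologicalSpace M]
    [ChartedSpace (EuclideanSpace ℝ (Fin m)) M] (i : Gr.Obj ⥤ T)
    [(IsTransportHom m M i).IsMultiplicative] :=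
  WideSubcategory (IsTransportHom m M i)

theorem DescentData.IsSmoothHom.comp {A B C : DescentData π i} {f : A ⟶ B} {g : B ⟶ C}
    (hf : IsSmoothHom f) (hg : IsSmoothHom g) : IsSmoothHom (f ≫ g) := by
  obtain ⟨h, h1, h2⟩ := hf
  obtain ⟨k, k1, k2⟩ := hg
  exact ⟨h ≪≫ k, fun y ↦ by simp [h1, k1], h2.comp k2⟩

theorem DescentData.IsSmooth.id {A : DescentData π i} (hA : A.IsSmooth) :
    IsSmoothHom (𝟙 A) :=
  ⟨Iso.refl _, fun y ↦ by simp, SmoothNatTrans.id hA.triv⟩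

/-- The functors with `π`-local `i`-trivialization whose descent data is smooth. -/
abbrev SmoothTrivializedFunctor (π : SurjSubmersion m M) (i : Gr.Obj ⥤ T) :=
  ObjectProperty.FullSubcategory (C := TrivializedFunctor π i)
    fun A ↦ ((extract π i).obj A).IsSmooth

/-- The natural transformations whose descent datum is smooth. -/
def IsSmoothTrivHom (π : SurjSubmersion m M) (i : Gr.Obj ⥤ T) :
    MorphismProperty (SmoothTrivializedFunctor π i) := fun _ _ f ↦
  DescentData.IsSmoothHom ((extract π i).map f.hom)

instance (π : SurjSubmersion m M) (i : Gr.Obj ⥤ T) :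
    (IsSmoothTrivHom π i).IsMultiplicative where
  id_mem A := by
    have := A.property.id
    rw [← (extract π i).map_id] at this
    exact this
  comp_mem f g hf hg := by
    have := hf.comp hg
    rw [← (extract π i).map_comp] at this
    exact this

/-- The category of functors with `π`-local `i`-trivialization having smooth descent data; the
morphisms are the natural transformations whose descent datum is smooth. -/
abbrev SmoothTrivCat (π : SurjSubmersion m M) (i : Gr.Obj ⥤ T) :=
  WideSubcategory (IsSmoothTrivHom π i)

/-- A natural transformation with smooth descent datum is a natural equivalence. -/
theorem isIso_of_isSmoothHom {A B : TrivializedFunctor π i} (f : A ⟶ B)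
    (hf : DescentData.IsSmoothHom ((extract π i).map f)) : IsIso f.α := by
  have h0 : ∃ h : A.loc.triv ≅ B.loc.triv, ∀ y, A.loc.t.inv.app y ≫
      f.α.app (π.push.obj y) ≫ B.loc.t.hom.app y = i.map (h.hom.app y) :=
    let ⟨h, h1, _⟩ := hf
    ⟨h, h1⟩
  obtain ⟨h, h1⟩ := h0
  suffices ∀ x, IsIso (f.α.app x) from NatIso.isIso_of_isIso_app _
  rintro ⟨x⟩
  obtain ⟨y, rfl⟩ := π.surj x
  have h3 : f.α.app (π.push.obj ⟨y⟩) =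
      A.loc.t.hom.app ⟨y⟩ ≫ i.map (h.hom.app ⟨y⟩) ≫ B.loc.t.inv.app ⟨y⟩ := by
    rw [← h1]
    simp
  have : IsIso (f.α.app (π.push.obj ⟨y⟩)) := by
    rw [h3]
    infer_instance
  exact this

/-- The forgetful functor `(F, triv, t) ↦ F` to transport functors. -/
def forgetTriv (π : SurjSubmersion m M) (i : Gr.Obj ⥤ T)
    [(IsTransportHom m M i).IsMultiplicative] : SmoothTrivCat π i ⥤ TransportCat m M i where
  obj A := ⟨⟨A.obj.obj.F, π, A.obj.obj.loc, A.obj.property⟩⟩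
  map {A B} f := ⟨⟨f.hom.hom.α⟩, isIso_of_isSmoothHom _ f.property,
    π, A.obj.obj.loc, B.obj.obj.loc, A.obj.property, B.obj.property, f.property⟩

end Descent

end Transport

open Transport

/-!
Since `i` is fully faithful, smoothness of natural transformations is automatic, and the statement
reduces to a construction of smooth functors.

*Natural transformations between smooth functors are smooth*
(`smoothNatTrans_of_smoothFunctor`). Near `x₀` there are paths `c x : x₀ → x` depending smoothly on
`x`, and naturality gives `η x = F (c x)⁻¹ ≫ η x₀ ≫ G (c x)`. The paths exist on manifolds and also on
`Y ×_M Y`, which is locally a smooth retract of `Y × Y` because in suitable coordinates a submersion is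
a linear projection (`exists_local_fibre_shift`). Hence descent data is smooth as soon as `triv` is
(`DescentData.isSmooth_of_smooth_triv`), the descent datum of a natural equivalence is smooth
(`isSmoothHom_of_isIso`), and the morphisms of transport functors are all natural equivalences
(`isTransportHom_iff_isIso`): a trivialization of the source is carried along the equivalence to one
of the target, with the same `triv`. So identities and composites are morphisms of transport
functors, and the forgetful functor is full; it is clearly faithful.

*Transport is smooth* (`LocalTrivialization.smoothWilsonAt_cls`). Let `L` be a trivialization of `F` over
some submersion, with smooth descent data. For a family of paths in `M` depending smoothly on a
parameter `u`, and smooth lifts of the end points, the morphisms of `Gr` that represent the values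
of `F` depend smoothly on `u`. For short paths this follows from a local section and the smoothness of
`triv`; two lifts of the same point differ by the smooth transition; and the property is transitive
under concatenation, so that it passes from short segments to all by connectedness of the line.

*Surjectivity* (`surjective_forgetTriv_obj`). A contraction of `Y` gives a path from each `y` to the base
point of its component. Choose objects of `Gr` representing `F` at the base points, and trivialize
`π^* F` by transport along these paths. The resulting `triv` sends a path in `Y` to a morphism
representing the value of `F` on a path between base points, which depends smoothly on the given
one by the previous paragraph.
-/

namespace Transport

open MixedManifold

/-! ### Local normal form of submersions -/

section Submersion

open Manifold

variable {E H N : Type*} [NormedAddCommGroup E] [NormedSpace ℝ E] [TopologicalSpace H]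
  [TopologicalSpace N] [ChartedSpace H N] {I : ModelWithCorners ℝ E H}

/-- Near a point `y₀`, a point `y` of the total space of a submersion can be moved smoothly into the
fibre over a given nearby point `x` of the base, and it stays where it is if it already lies over
`x`. In the coordinates in which the submersion is a linear projection, only the base coordinates of
`y` are changed. -/
theorem exists_local_fibre_shift {E'' : Type*} [NormedAddCommGroup E''] [NormedSpace ℝ E'']
    {H'' : Type*} [TopologicalSpace H''] {Z : Type*} [TopologicalSpace Z] [ChartedSpace H'' Z]
    {K : ModelWithCorners ℝ E'' H''} [K.Boundaryless] {f : Z → N} {y₀ : Z}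
    (hf : IsSubmersionAt K I ∞ f y₀) :
    ∃ (ρ : N × Z → Z) (W : Set (N × Z)), IsOpen W ∧ (f y₀, y₀) ∈ W ∧
      ContMDiffOn (I.prod K) K ∞ ρ W ∧ (∀ p ∈ W, f (ρ p) = p.1) ∧
      ∀ y, (f y, y) ∈ W → ρ (f y, y) = y := by
  set Φ := hf.domChart.extend K with hΦ
  set Ψ := hf.codChart.extend I with hΨ
  set e := hf.equiv
  have hΦs : Φ.source = hf.domChart.source := hf.domChart.extend_source
  have hΨs : Ψ.source = hf.codChart.source := hf.codChart.extend_source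
  have cΦ : ContMDiffOn K 𝓘(ℝ, E'') ∞ Φ Φ.source := by
    rw [hΦs]; exact hf.domChart.contMDiffOn_extend hf.domChart_mem_maximalAtlas
  have cΨ : ContMDiffOn I 𝓘(ℝ, E) ∞ Ψ Ψ.source := by
    rw [hΨs]; exact hf.codChart.contMDiffOn_extend hf.codChart_mem_maximalAtlas
  have cΦ' : ContMDiffOn 𝓘(ℝ, E'') K ∞ Φ.symm Φ.target := by
    rw [hΦ, OpenPartialHomeomorph.extend_target']
    exact contMDiffOn_extend_symm hf.domChart_mem_maximalAtlas
  have oΦ : IsOpen Φ.source := by rw [hΦs]; exact hf.domChart.open_source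
  have oΨ : IsOpen Ψ.source := by rw [hΨs]; exact hf.codChart.open_source
  have oΦ' : IsOpen Φ.target := hf.domChart.isOpen_extend_target
  set g : N × Z → E'' := fun p ↦ e.symm (Ψ p.1, (e (Φ p.2)).2)
  have cg : ContMDiffOn (I.prod K) 𝓘(ℝ, E'') ∞ g (Ψ.source ×ˢ Φ.source) := by
    have c1 : ContMDiffOn (I.prod K) 𝓘(ℝ, E) ∞ (fun p : N × Z ↦ Ψ p.1) (Ψ.source ×ˢ Φ.source) :=
      cΨ.comp contMDiffOn_fst fun p hp ↦ hp.1
    have c2 : ContMDiffOn (I.prod K) 𝓘(ℝ, E'') ∞ (fun p : N × Z ↦ Φ p.2) (Ψ.source ×ˢ Φ.source) :=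
      cΦ.comp contMDiffOn_snd fun p hp ↦ hp.2
    have l : ContMDiff 𝓘(ℝ, E'') 𝓘(ℝ, hf.complement) ∞ (fun x ↦ (e x).2) :=
      (contDiff_snd.comp e.contDiff).contMDiff
    exact e.symm.contDiff.contMDiff.comp_contMDiffOn (c1.prodMk_space (l.comp_contMDiffOn c2))
  have hfy : ∀ y ∈ Φ.source, Ψ (f y) = (e (Φ y)).1 := by
    intro y hy
    have := hf.writtenInCharts (Φ.map_source hy)
    rwa [Function.comp_apply, Function.comp_apply, Function.comp_apply, Φ.left_inv hy] at this
  have hfs : ∀ y ∈ Φ.source, f y ∈ Ψ.source := by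
    intro y hy
    rw [hΨs]
    exact hf.source_subset_preimage_source (hΦs ▸ hy)
  have hgy : ∀ y ∈ Φ.source, g (f y, y) = Φ y := by
    intro y hy
    simp only [g, hfy y hy]
    exact e.symm_apply_apply _
  have h0 : y₀ ∈ Φ.source := by rw [hΦs]; exact hf.mem_domChart_source
  -- In the coordinates `Φ`, `Ψ` the map is the projection `fst ∘ e`; `g (x, y)` replaces the first
  -- component of the coordinates of `y` by those of `x`.
  refine ⟨Φ.symm ∘ g, (Ψ.source ×ˢ Φ.source) ∩ g ⁻¹' Φ.target,
    cg.continuousOn.isOpen_inter_preimage (oΨ.prod oΦ) oΦ', ⟨⟨hfs _ h0, h0⟩, ?_⟩,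
    cΦ'.comp (cg.mono inter_subset_left) inter_subset_right, ?_, ?_⟩
  · simpa [hgy _ h0] using Φ.map_source h0
  · rintro ⟨x, y⟩ ⟨⟨hx, hy⟩, hp⟩
    have h1 := Φ.map_target hp
    refine Ψ.injOn (hfs _ h1) hx ?_
    change Ψ (f (Φ.symm (g (x, y)))) = Ψ x
    rw [hfy _ h1, Φ.right_inv hp]
    simp [g]
  · rintro y ⟨⟨-, hy⟩, -⟩
    rw [Function.comp_apply, hgy y hy, Φ.left_inv hy]

end Submersion

/-! ### Pointwise smoothness of maps to manifolds of mixed dimension -/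

section SmoothMapAt

variable {E H P : Type*} [NormedAddCommGroup E] [NormedSpace ℝ E] [TopologicalSpace H]
  [TopologicalSpace P] [ChartedSpace H P] {J : ModelWithCorners ℝ E H}
  {E' H' Q : Type*} [NormedAddCommGroup E'] [NormedSpace ℝ E'] [TopologicalSpace H']
  [TopologicalSpace Q] [ChartedSpace H' Q] {J' : ModelWithCorners ℝ E' H'}
  {X : Type*} {ι : X → Q}
  {Z : Type w} [MixedManifold Z] {Gr : LieGroupoid.{u, v}}

/-- Smoothness at a point of a map from a manifold to a manifold with components of possibly different
dimensions. -/
def SmoothMapAt (J : ModelWithCorners ℝ E H) (f : P → Z) (p : P) : Prop :=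
  ∃ (n : ℕ) (F : P → part Z n), ContMDiffAt J (𝓡 n) ∞ F p ∧ ∀ᶠ q in 𝓝 p, f q = incl Z n (F q)

theorem smoothMapAt_const (z : Z) (p : P) : SmoothMapAt J (fun _ ↦ z) p := by
  obtain ⟨⟨n, z'⟩, rfl⟩ := (equiv : _ ≃ Z).surjective z
  exact ⟨n, fun _ ↦ z', contMDiffAt_const, .of_forall fun _ ↦ rfl⟩

theorem SmoothMapAt.congr {f g : P → Z} {p : P} (hf : SmoothMapAt J f p)
    (h : ∀ᶠ q in 𝓝 p, g q = f q) : SmoothMapAt J g p := by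
  obtain ⟨n, F, hF, e⟩ := hf
  exact ⟨n, F, hF, by filter_upwards [e, h] with q h1 h2; rw [h2, h1]⟩

theorem SmoothMapAt.comp {f : Q → Z} {g : P → Q} {p : P} (hf : SmoothMapAt J' f (g p))
    (hg : ContMDiffAt J J' ∞ g p) : SmoothMapAt J (f ∘ g) p := by
  obtain ⟨n, F, hF, e⟩ := hf
  exact ⟨n, F ∘ g, hF.comp p hg, hg.continuousAt.eventually e⟩

/-- A smooth map on `X ⊆ Q` composed with a smooth map to `Q` taking values in `X`. -/
theorem SmoothMap.comp_smoothMapAt {f : X → Z} (hf : SmoothMap J' ι f) {g : P → X} {p : P}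
    (hg : ContMDiffAt J J' ∞ (ι ∘ g) p) : SmoothMapAt J (f ∘ g) p := by
  obtain ⟨n, F, hF, e⟩ := hf (g p)
  refine ⟨n, F ∘ (ι ∘ g), ?_, ?_⟩
  · have := ContMDiffWithinAt.comp (s := univ) (t := range ι) p hF hg.contMDiffWithinAt
      (fun _ _ ↦ ⟨_, rfl⟩)
    exact contMDiffWithinAt_univ.1 this
  · rw [Filter.eventually_comap] at e
    filter_upwards [hg.continuousAt.eventually e] with q hq
    exact hq _ rfl

/-- A map on `X ⊆ Q` that locally extends to a smooth map on `Q` is smooth. -/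
theorem smoothMap_of_smoothMapAt {f : X → Z}
    (h : ∀ x, ∃ g : Q → Z, SmoothMapAt J' g (ι x) ∧ ∀ᶠ x' in Filter.comap ι (𝓝 (ι x)),
      f x' = g (ι x')) : SmoothMap J' ι f := by
  intro x
  obtain ⟨g, ⟨n, F, hF, e⟩, e'⟩ := h x
  refine ⟨n, F, hF.contMDiffWithinAt, ?_⟩
  filter_upwards [e', e.comap ι] with x' h1 h2
  rw [h1, h2]

/-- On an open subset, smoothness is smoothness at each point. -/
theorem smoothMap_subtype_iff {U : Set Q} (hU : IsOpen U) {f : Q → Z} :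
    SmoothMap J' (Subtype.val : U → Q) (fun u ↦ f u) ↔ ∀ u ∈ U, SmoothMapAt J' f u := by
  refine ⟨fun h u hu ↦ ?_, fun h ↦ smoothMap_of_smoothMapAt fun x ↦
    ⟨f, h x x.2, .of_forall fun _ ↦ rfl⟩⟩
  obtain ⟨n, F, hF, e⟩ := h ⟨u, hu⟩
  rw [Subtype.range_coe] at hF
  refine ⟨n, F, hF.contMDiffAt (hU.mem_nhds hu), ?_⟩
  rw [Filter.eventually_comap] at e
  filter_upwards [e, hU.mem_nhds hu] with q h1 h2
  exact h1 ⟨q, h2⟩ rfl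

/-- Pointwise composites of smooth families of composable arrows are smooth; composability is only
needed near the given point. -/
theorem SmoothMapAt.mor_comp {a b c : P → Mor Gr.Obj} {p : P} (ha : SmoothMapAt J a p)
    (hb : SmoothMapAt J b p)
    (hc : ∀ᶠ q in 𝓝 p, ∃ h : (a q).tgt = (b q).src, c q = Mor.comp (a q) (b q) h) :
    SmoothMapAt J c p := by
  obtain ⟨n, A, hA, ea⟩ := ha
  obtain ⟨k, B, hB, eb⟩ := hb
  have key : ∀ᶠ q in 𝓝 p, ∃ h : (incl (Mor Gr.Obj) n (A q)).tgt = (incl (Mor Gr.Obj) k (B q)).src,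
      c q = Mor.comp (incl _ n (A q)) (incl _ k (B q)) h := by
    filter_upwards [ea, eb, hc] with q h1 h2 h3
    rwa [← h1, ← h2]
  set S := {q : part (Mor Gr.Obj) n × part (Mor Gr.Obj) k //
      (incl _ n q.1).tgt = (incl _ k q.2).src}
  let s₀ : S := ⟨(A p, B p), key.self_of_nhds.choose⟩
  classical
  let g : P → S := fun q ↦ if h : _ then ⟨(A q, B q), h⟩ else s₀
  have hg : ContMDiffAt J ((𝓡 n).prod (𝓡 k)) ∞ (Subtype.val ∘ g) p := by
    refine (hA.prodMk hB).congr_of_eventuallyEq ?_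
    filter_upwards [key] with q ⟨h, _⟩
    simp only [Function.comp, g, dif_pos h]
  refine (SmoothMap.comp_smoothMapAt (Gr.smooth_comp n k) hg).congr ?_
  filter_upwards [key] with q ⟨h, hq⟩
  rw [hq]
  simp only [Function.comp, g, dif_pos h]

theorem SmoothMapAt.exists_mor_comp {a b : P → Mor Gr.Obj} {p : P} (ha : SmoothMapAt J a p)
    (hb : SmoothMapAt J b p) (h : ∀ᶠ q in 𝓝 p, (a q).tgt = (b q).src) :
    ∃ c, SmoothMapAt J c p ∧
      ∀ᶠ q in 𝓝 p, ∃ h : (a q).tgt = (b q).src, c q = Mor.comp (a q) (b q) h := by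
  classical
  have key : ∀ᶠ q in 𝓝 p, ∃ h : (a q).tgt = (b q).src,
      (if h : (a q).tgt = (b q).src then Mor.comp (a q) (b q) h else a q) =
        Mor.comp (a q) (b q) h := by
    filter_upwards [h] with q hq
    exact ⟨hq, dif_pos hq⟩
  exact ⟨_, ha.mor_comp hb key, key⟩

theorem Mor.comp_mk {G : Type u} [Category.{v} G] {a b c : G} (f : a ⟶ b) (g : b ⟶ c) :
    Mor.comp ⟨a, b, f⟩ ⟨b, c, g⟩ rfl = ⟨a, c, f ≫ g⟩ := by
  simp [Mor.comp]

theorem SmoothMapAt.comp_hom {x y z : P → Gr.Obj} {f : ∀ q, x q ⟶ y q} {g : ∀ q, y q ⟶ z q} {p : P}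
    (hf : SmoothMapAt J (fun q ↦ (⟨_, _, f q⟩ : Mor Gr.Obj)) p)
    (hg : SmoothMapAt J (fun q ↦ (⟨_, _, g q⟩ : Mor Gr.Obj)) p) :
    SmoothMapAt J (fun q ↦ (⟨_, _, f q ≫ g q⟩ : Mor Gr.Obj)) p :=
  hf.mor_comp hg (.of_forall fun _ ↦ ⟨rfl, (Mor.comp_mk _ _).symm⟩)

/-- Transport of smoothness along smooth families of paths, at a single parameter value. -/
theorem SmoothFunctor.smoothMapAt {F : PathGroupoid J' ι ⥤ Gr.Obj} (hF : SmoothFunctor F) {k : ℕ}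
    {U : Set (EuclideanSpace ℝ (Fin k))} (hU : IsOpen U)
    (c : EuclideanSpace ℝ (Fin k) → PathSpace J' ι)
    (hc : ContMDiffOn 𝓘(ℝ, EuclideanSpace ℝ (Fin k) × ℝ) J' ∞
        (fun p ↦ ι ((c p.1).path.toFun p.2)) (U ×ˢ Icc 0 1))
    {u₀ : EuclideanSpace ℝ (Fin k)} (hu : u₀ ∈ U) :
    SmoothMapAt 𝓘(ℝ, EuclideanSpace ℝ (Fin k))
      (fun u ↦ (⟨_, _, F.map (c u).path.cls⟩ : Mor Gr.Obj)) u₀ :=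
  (smoothMap_subtype_iff hU).1 (hF.map k U hU c hc) u₀ hu

end SmoothMapAt


/-! ### Segments of curves in the path groupoid -/

section PathAlgebra

variable {E H N X : Type*} [NormedAddCommGroup E] [NormedSpace ℝ E] [TopologicalSpace H]
  [TopologicalSpace N] [ChartedSpace H N] {I : ModelWithCorners ℝ E H} {ι : X → N}

namespace SPath

/-- The part of a smooth curve `Γ` from the parameter `a` to the parameter `b` (in either order),
reparametrized so as to have sitting instants. -/
noncomputable def segment (Γ : ℝ → X) (hΓ : ContMDiff 𝓘(ℝ, ℝ) I ∞ (ι ∘ Γ)) (a b : ℝ) :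
    SPath I ι (Γ a) (Γ b) where
  toFun := fun t ↦ Γ (a + (b - a) * step t)
  smooth := hΓ.comp
    (show ContDiff ℝ ∞ (fun t : ℝ ↦ a + (b - a) * step t) by
      have := step_contDiff
      fun_prop).contMDiff
  sitting := by
    refine ⟨1 / 3, by norm_num, by norm_num, fun t ht ↦ ?_, fun t ht ↦ ?_⟩
    · rw [step_zero ht.le]; simp
    · rw [step_one (by linarith)]; simp

theorem segment_concat {Γ : ℝ → X} (hΓ : ContMDiff 𝓘(ℝ, ℝ) I ∞ (ι ∘ Γ)) (a b c : ℝ) :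
    (segment Γ hΓ a b).cls ≫ (segment Γ hΓ b c).cls = (segment Γ hΓ a c).cls := by
  refine Quotient.sound (thinHomotopic_of_curve (ε := 1 / 6) hΓ
    (a := fun t ↦ a + (b - a) * step (2 * t) + (c - b) * step (2 * t - 1))
    (b := fun t ↦ a + (c - a) * step t) ?_ ?_ _ _ ?_ (fun _ ↦ rfl) (by norm_num) ?_ ?_)
  · have h1 : ContDiff ℝ ∞ fun t : ℝ ↦ step (2 * t) := step_contDiff.comp (by fun_prop)
    have h2 : ContDiff ℝ ∞ fun t : ℝ ↦ step (2 * t - 1) := step_contDiff.comp (by fun_prop)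
    fun_prop
  · have := step_contDiff
    fun_prop
  · intro t
    simp only [concat, segment]
    split_ifs
    · rw [step_zero (t := 2 * t - 1) (by linarith), mul_zero, add_zero]
    · rw [step_one (t := 2 * t) (by linarith)]
      ring_nf
  · intro r t _ _ ht
    rw [step_zero (t := 2 * t) (by linarith), step_zero (t := 2 * t - 1) (by linarith),
      step_zero (t := t) (by linarith)]
    ring_nf
  · intro r t _ _ ht
    rw [step_one (t := 2 * t) (by linarith), step_one (t := 2 * t - 1) (by linarith),
      step_one (t := t) (by linarith)]
    ring_nf

theorem cls_slow {x y : X} (γ : SPath I ι x y) : γ.slow.cls = γ.cls :=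
  Quotient.sound γ.thinHomotopic_slow.symm

theorem cls_reverse {x y : X} (γ : SPath I ι x y) : γ.reverse.cls = inv γ.cls := by
  rw [← Groupoid.inv_eq_inv]
  rfl

theorem ext_toFun {x y : X} {γ γ' : SPath I ι x y} (h : γ.toFun = γ'.toFun) : γ = γ' := by
  cases γ
  cases γ'
  cases h
  rfl

end SPath

end PathAlgebra

/-! ### Automatic smoothness of natural transformations -/

section Automatic

variable {E H N X : Type*} [NormedAddCommGroup E] [NormedSpace ℝ E] [TopologicalSpace H]
  [TopologicalSpace N] [ChartedSpace H N] {I : ModelWithCorners ℝ E H} {ι : X → N}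

/-- `X ⊆ N` is locally a smooth retract of `N`. -/
def HasLocalRetractions (I : ModelWithCorners ℝ E H) (ι : X → N) : Prop :=
  ∀ x, ∃ (r : N → X) (V : Set N), IsOpen V ∧ ι x ∈ V ∧ ContMDiffOn I I ∞ (ι ∘ r) V ∧
    ∀ x', ι x' ∈ V → r (ι x') = x'

theorem hasLocalRetractions_id : HasLocalRetractions I (id : N → N) :=
  fun _ ↦ ⟨id, univ, isOpen_univ, mem_univ _, contMDiffOn_id, fun _ _ ↦ rfl⟩

/-- Each point `x₀` of a local smooth retract is joined to the nearby points `x` by paths that depend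
smoothly on `x`. In a chart of the ambient manifold these are the straight segments, pushed into `X`
by the retraction. -/
theorem HasLocalRetractions.exists_paths [FiniteDimensional ℝ E] [I.Boundaryless]
    [IsManifold I ∞ N] (h : HasLocalRetractions I ι) (x₀ : X) :
    ∃ (k : ℕ) (U : Set (EuclideanSpace ℝ (Fin k)))
      (tgt : EuclideanSpace ℝ (Fin k) → X)
      (c : ∀ u, SPath I ι x₀ (tgt u)) (χ : N → EuclideanSpace ℝ (Fin k)), IsOpen U ∧
      ContMDiffOn 𝓘(ℝ, EuclideanSpace ℝ (Fin k) × ℝ) I ∞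
        (fun p ↦ ι ((c p.1).toFun p.2)) (U ×ˢ univ) ∧
      ContMDiffAt I 𝓘(ℝ, EuclideanSpace ℝ (Fin k)) ∞ χ (ι x₀) ∧ χ (ι x₀) ∈ U ∧
      ∀ᶠ x in Filter.comap ι (𝓝 (ι x₀)), tgt (χ (ι x)) = x := by
  obtain ⟨r, V, hV, hxV, hr, hrV⟩ := h x₀
  set φ := extChartAt I (ι x₀)
  have cφ : ContMDiffOn 𝓘(ℝ, E) I ∞ φ.symm φ.target := contMDiffOn_extChartAt_symm _
  have oS : IsOpen (φ.target ∩ φ.symm ⁻¹' V) :=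
    cφ.continuousOn.isOpen_inter_preimage (isOpen_extChartAt_target _) hV
  have hS : φ (ι x₀) ∈ φ.target ∩ φ.symm ⁻¹' V :=
    ⟨mem_extChartAt_target _, by simpa [φ] using hxV⟩
  obtain ⟨ε, hε, hB⟩ := Metric.isOpen_iff.1 oS _ hS
  set z₀ := φ (ι x₀)
  obtain ⟨k, ⟨e⟩⟩ : ∃ k : ℕ, Nonempty (E ≃L[ℝ] EuclideanSpace ℝ (Fin k)) := ⟨_, ⟨toEuclidean⟩⟩
  set U := e.symm ⁻¹' Metric.ball z₀ ε
  let Γ : EuclideanSpace ℝ (Fin k) → ℝ → X := fun u t ↦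
    r (φ.symm (z₀ + SPath.step t • (e.symm u - z₀)))
  have hseg : ∀ u ∈ U, ∀ t, z₀ + SPath.step t • (e.symm u - z₀) ∈ φ.target ∩ φ.symm ⁻¹' V := by
    intro u hu t
    refine hB ?_
    have hu' : ‖e.symm u - z₀‖ < ε := by simpa [U, dist_eq_norm] using hu
    rw [Metric.mem_ball, dist_eq_norm, add_sub_cancel_left, norm_smul, Real.norm_eq_abs,
      abs_of_nonneg (SPath.step_nonneg t)]
    nlinarith [SPath.step_nonneg t, SPath.step_le_one t, norm_nonneg (e.symm u - z₀)]
  have hΓ : ContMDiffOn 𝓘(ℝ, EuclideanSpace ℝ (Fin k) × ℝ) I ∞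
      (fun p ↦ ι (Γ p.1 p.2)) (U ×ˢ univ) := by
    have h1 : ContDiff ℝ ∞ fun p : EuclideanSpace ℝ (Fin k) × ℝ ↦
        z₀ + SPath.step p.2 • (e.symm p.1 - z₀) := by
      have h2 := SPath.step_contDiff.comp
        (contDiff_snd (𝕜 := ℝ) (E := EuclideanSpace ℝ (Fin k)) (F := ℝ))
      have h3 := e.symm.contDiff (n := ∞) |>.comp
        (contDiff_fst (𝕜 := ℝ) (E := EuclideanSpace ℝ (Fin k)) (F := ℝ))
      exact contDiff_const.add (h2.smul (h3.sub contDiff_const))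
    refine hr.comp ((cφ.mono inter_subset_left).comp (t := φ.target ∩ φ.symm ⁻¹' V)
      h1.contMDiff.contMDiffOn ?_) ?_
    · exact fun p hp ↦ hseg _ hp.1 _
    · exact fun p hp ↦ (hseg _ hp.1 _).2
  have hx₀ : r (φ.symm z₀) = x₀ := by
    rw [extChartAt_to_inv]
    exact hrV _ hxV
  have hu₀ : e z₀ ∈ U := by simpa [U] using hε
  let c' : ∀ u ∈ U, SPath I ι x₀ (Γ u 1) := fun u hu ↦
    { toFun := Γ u
      smooth := by
        have h1 : ContDiff ℝ ∞ fun t : ℝ ↦ (u, t) := by fun_prop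
        have h2 : ContMDiffOn 𝓘(ℝ, ℝ) I ∞
            ((fun p : EuclideanSpace ℝ (Fin k) × ℝ ↦ ι (Γ p.1 p.2)) ∘ fun t ↦ (u, t)) univ :=
          hΓ.comp h1.contMDiff.contMDiffOn fun t _ ↦ ⟨hu, mem_univ _⟩
        exact contMDiffOn_univ.1 h2
      sitting := by
        refine ⟨1 / 3, by norm_num, by norm_num, fun t ht ↦ ?_, fun t ht ↦ ?_⟩
        · simp only [Γ]
          rw [SPath.step_zero ht.le, zero_smul, add_zero, hx₀]
        · simp only [Γ]
          rw [SPath.step_one (by linarith), SPath.step_one (by linarith)] }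
  classical
  let C : EuclideanSpace ℝ (Fin k) → Σ y, SPath I ι x₀ y := fun u ↦
    if hu : u ∈ U then ⟨_, c' u hu⟩ else ⟨_, SPath.const I ι x₀⟩
  have hC : ∀ u, ∀ hu : u ∈ U, C u = ⟨_, c' u hu⟩ := fun u hu ↦ dif_pos hu
  refine ⟨_, U, fun u ↦ (C u).1, fun u ↦ (C u).2, fun n ↦ e (φ n),
    Metric.isOpen_ball.preimage e.symm.continuous, hΓ.congr ?_, ?_, hu₀, ?_⟩
  · rintro ⟨u, t⟩ ⟨hu, -⟩
    change ι ((C u).2.toFun t) = _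
    rw [hC u hu]
  · have h1 : ContMDiff 𝓘(ℝ, E) 𝓘(ℝ, EuclideanSpace ℝ (Fin k)) ∞ e := e.contDiff.contMDiff
    exact h1.contMDiffAt.comp _ contMDiffAt_extChartAt
  · have h1 : ∀ᶠ n in 𝓝 (ι x₀), e (φ n) ∈ U :=
      (e.continuous.continuousAt.comp (continuousAt_extChartAt _)).eventually_mem
        ((Metric.isOpen_ball.preimage e.symm.continuous).mem_nhds hu₀)
    filter_upwards [(h1.and ((extChartAt_source_mem_nhds (I := I) (ι x₀)))).and
      (hV.mem_nhds hxV) |>.comap ι] with x ⟨⟨h2, h3⟩, h4⟩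
    rw [hC _ h2]
    simp only [Γ]
    rw [SPath.step_one (by norm_num), one_smul, e.symm_apply_apply, add_sub_cancel,
      φ.left_inv h3, hrV _ h4]

/-- Natural transformations between smooth functors are automatically smooth: near `x₀`, naturality
expresses the component at `x` by the component at `x₀` and parallel transport along paths
from `x₀` to `x` that depend smoothly on `x`. -/
theorem smoothNatTrans_of_smoothFunctor [FiniteDimensional ℝ E] [I.Boundaryless]
    [IsManifold I ∞ N] (h : HasLocalRetractions I ι) {Gr : LieGroupoid.{u, v}}
    {F G : PathGroupoid I ι ⥤ Gr.Obj} (hF : SmoothFunctor F) (hG : SmoothFunctor G) (η : F ⟶ G) :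
    SmoothNatTrans η := by
  refine smoothMap_of_smoothMapAt fun x₀ ↦ ?_
  obtain ⟨k, U, tgt, c, χ, hU, hc, hχ, hu, htgt⟩ := h.exists_paths x₀
  have hc' := hc.mono (prod_mono_right (subset_univ (Icc (0 : ℝ) 1)))
  have hrev : ContDiff ℝ ∞ fun p : EuclideanSpace ℝ (Fin k) × ℝ ↦ (p.1, 1 - p.2) := by fun_prop
  have h1 := hF.smoothMapAt hU (fun u ↦ ⟨_, _, (c u).reverse⟩)
    (hc.comp hrev.contMDiff.contMDiffOn fun p hp ↦ ⟨hp.1, mem_univ _⟩) hu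
  have h2 := hG.smoothMapAt hU (fun u ↦ ⟨_, _, c u⟩) hc' hu
  have h3 : SmoothMapAt 𝓘(ℝ, EuclideanSpace ℝ (Fin k))
      (fun u ↦ (⟨_, _, η.app ⟨tgt u⟩⟩ : Mor Gr.Obj)) (χ (ι x₀)) := by
    have key : ∀ u, η.app ⟨tgt u⟩ =
        (F.map (c u).reverse.cls ≫ η.app ⟨x₀⟩) ≫ G.map (c u).cls := fun u ↦ by
      rw [Category.assoc, ← η.naturality, ← F.map_comp_assoc, SPath.cls_reverse]
      simp
    simp only [key]
    exact (h1.comp_hom (f := fun u ↦ F.map (c u).reverse.cls)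
      (smoothMapAt_const (⟨_, _, η.app ⟨x₀⟩⟩ : Mor Gr.Obj) _)).comp_hom h2
  refine ⟨_, h3.comp hχ, ?_⟩
  filter_upwards [htgt] with x hx
  simp only [Function.comp]
  rw [hx]

end Automatic


/-! ### Pullback of smooth functors -/

section Pullback

variable {E H N X : Type*} [NormedAddCommGroup E] [NormedSpace ℝ E] [TopologicalSpace H]
  [TopologicalSpace N] [ChartedSpace H N] {I : ModelWithCorners ℝ E H} {ι : X → N}
  {E' H' N' X' : Type*} [NormedAddCommGroup E'] [NormedSpace ℝ E'] [TopologicalSpace H']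
  [TopologicalSpace N'] [ChartedSpace H' N'] {I' : ModelWithCorners ℝ E' H'} {ι' : X' → N'}
  {Gr : LieGroupoid.{u, v}}

/-- The pullback of a smooth functor along a smooth map is smooth. -/
theorem SmoothFunctor.pullback {f : X → X'} (hf : RestrictsSmooth I ι I' ι' f)
    {F : PathGroupoid I' ι' ⥤ Gr.Obj} (hF : SmoothFunctor F) :
    SmoothFunctor (pushforward hf ⋙ F) := by
  have hf' := hf
  obtain ⟨φ, hφ, e⟩ := hf'
  constructor
  · intro x
    obtain ⟨n, A, hA, hA'⟩ := hF.obj (f x)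
    rw [e] at hA
    refine ⟨n, A ∘ φ, hA.comp (ι x) hφ.contMDiffAt.contMDiffWithinAt ?_, ?_⟩
    · rintro _ ⟨x', rfl⟩
      exact ⟨f x', e x'⟩
    · rw [e, Filter.eventually_comap] at hA'
      filter_upwards [(hφ.continuous.continuousAt.eventually hA').comap ι] with x' h
      rw [Function.comp_apply, ← e]
      exact h _ (e x')
  · intro k U hU c hc
    refine hF.map k U hU (fun u ↦ ⟨_, _, (c u).path.map hf⟩) ?_
    have : (fun p : EuclideanSpace ℝ (Fin k) × ℝ ↦ ι' (((c p.1).path.map hf).toFun p.2)) =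
      φ ∘ fun p ↦ ι ((c p.1).path.toFun p.2) := funext fun p ↦ e _
    rw [this]
    exact hφ.comp_contMDiffOn hc

end Pullback

/-! ### Natural equivalences and fully faithful functors -/

section Lift

variable {A : Type*} [Category A] {B : Type*} [Category B] {C : Type*} [Category C]

theorem exists_natIso_lift (i : B ⥤ C) [i.Full] [i.Faithful] {F G : A ⥤ B} (e : F ⋙ i ≅ G ⋙ i) :
    ∃ e' : F ≅ G, ∀ x, e.hom.app x = i.map (e'.hom.app x) := by
  refine ⟨NatIso.ofComponents (fun x ↦ i.preimageIso (e.app x)) fun {x y} f ↦ ?_, fun x ↦ ?_⟩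
  · apply i.map_injective
    simpa using e.hom.naturality f
  · simp

end Lift

/-! ### Smooth descent data and morphisms of transport functors -/

section Characterization

variable {m : ℕ} {M : Type u} [TopologicalSpace M] [ChartedSpace (EuclideanSpace ℝ (Fin m)) M]

theorem SurjSubmersion.hasLocalRetractions_fib₂ (π : SurjSubmersion m M) :
    HasLocalRetractions ((𝓡 π.dim).prod (𝓡 π.dim))
      (Subtype.val : π.Fib₂ → π.total × π.total) := by
  rintro ⟨⟨y₀, y₁⟩, h₀⟩
  obtain ⟨ρ, W, hW, hW₀, cρ, hρ, hρ'⟩ := exists_local_fibre_shift (π.submersion.isSubmersionAt y₁)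
  classical
  have hπ := π.submersion.contMDiff
  have hg : ContMDiff ((𝓡 π.dim).prod (𝓡 π.dim)) ((𝓡 m).prod (𝓡 π.dim)) ∞
      (fun p : π.total × π.total ↦ (π.proj p.1, p.2)) :=
    (hπ.comp contMDiff_fst).prodMk contMDiff_snd
  let r : π.total × π.total → π.Fib₂ := fun p ↦
    if h : π.proj p.1 = π.proj (ρ (π.proj p.1, p.2)) then ⟨(p.1, ρ (π.proj p.1, p.2)), h⟩
    else ⟨(y₀, y₁), h₀⟩
  have hr : ∀ p : π.total × π.total, (π.proj p.1, p.2) ∈ W →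
      (r p).1 = (p.1, ρ (π.proj p.1, p.2)) := fun p hp ↦ by
    simp only [r]
    rw [dif_pos (hρ _ hp).symm]
  refine ⟨r, (fun p ↦ (π.proj p.1, p.2)) ⁻¹' W, hW.preimage hg.continuous, ?_, ?_, ?_⟩
  · simpa [h₀] using hW₀
  · refine ContMDiffOn.congr (contMDiffOn_fst.prodMk (cρ.comp hg.contMDiffOn fun p hp ↦ hp)) ?_
    exact fun p hp ↦ hr p hp
  · rintro ⟨⟨y, y'⟩, h⟩ hp
    refine Subtype.ext ((hr _ hp).trans ?_)
    simp only [mem_preimage] at hp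
    change (y, ρ (π.proj y, y')) = (y, y')
    rw [show π.proj y = π.proj y' from h] at hp ⊢
    rw [hρ' _ hp]

variable {Gr : LieGroupoid.{u₁, v₁}} {T : Type u₂} [Category.{v₂} T]
  {π : SurjSubmersion m M} {i : Gr.Obj ⥤ T}

/-- If `i` is fully faithful, then descent data is smooth as soon as `triv` is. -/
theorem DescentData.isSmooth_of_smooth_triv [i.Full] [i.Faithful] {D : DescentData π i}
    (h : SmoothFunctor D.triv) : D.IsSmooth := by
  obtain ⟨g', hg'⟩ := exists_natIso_lift i (F := π.push₁ ⋙ D.triv) (G := π.push₂ ⋙ D.triv) D.g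
  exact ⟨h, g', hg', smoothNatTrans_of_smoothFunctor π.hasLocalRetractions_fib₂
    (h.pullback π.restrictsSmooth_fst) (h.pullback π.restrictsSmooth_snd) g'.hom⟩

/-- If `i` is fully faithful, then the descent datum of every natural equivalence is smooth. -/
theorem isSmoothHom_of_isIso [i.Full] [i.Faithful] {A B : TrivializedFunctor π i} (f : A ⟶ B)
    [IsIso f.α] (hA : SmoothFunctor A.loc.triv) (hB : SmoothFunctor B.loc.triv) :
    DescentData.IsSmoothHom ((extract π i).map f) := by
  obtain ⟨h', e⟩ := exists_natIso_lift i
    (A.loc.t.symm ≪≫ Functor.isoWhiskerLeft π.push (asIso f.α) ≪≫ B.loc.t)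
  exact ⟨h', e, smoothNatTrans_of_smoothFunctor hasLocalRetractions_id hA hB h'.hom⟩

/-- A local trivialization of a functor is also one of every equivalent functor. -/
noncomputable def LocalTrivialization.ofIso {F F' : P₁ m M ⥤ T} (L : LocalTrivialization π i F)
    (η : F ≅ F') : LocalTrivialization π i F' where
  triv := L.triv
  t := Functor.isoWhiskerLeft π.push η.symm ≪≫ L.t

/-- If `i` is fully faithful, then the morphisms of transport functors are all natural
equivalences: a smooth trivialization of the source is carried along the equivalence to one
of the target. -/
theorem isTransportHom_iff_isIso [i.Full] [i.Faithful] {F F' : TransportFunctor m M i}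
    (η : F ⟶ F') : IsTransportHom m M i η ↔ IsIso η.hom := by
  refine ⟨fun h ↦ h.1, fun h ↦ ⟨h, ?_⟩⟩
  obtain ⟨π, L, hL⟩ := F.property
  exact ⟨π, L, L.ofIso (asIso η.hom), hL, DescentData.isSmooth_of_smooth_triv hL.triv,
    isSmoothHom_of_isIso _ hL.triv hL.triv⟩

theorem isMultiplicative_isTransportHom (i : Gr.Obj ⥤ T) [i.Full] [i.Faithful] :
    (IsTransportHom m M i).IsMultiplicative where
  id_mem F := by
    rw [isTransportHom_iff_isIso]
    exact inferInstanceAs (IsIso (𝟙 F.obj))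
  comp_mem f g hf hg := by
    rw [isTransportHom_iff_isIso] at hf hg ⊢
    exact inferInstanceAs (IsIso (f.hom ≫ g.hom))

theorem isEquivalence_forgetTriv [i.Full] [i.Faithful] [(IsTransportHom m M i).IsMultiplicative]
    (h : Function.Surjective (forgetTriv π i).obj) : (forgetTriv π i).IsEquivalence where
  faithful := ⟨fun {A B f g} e ↦ by
    have e' : f.hom.hom.α = g.hom.hom.α :=
      congrArg (fun k : (forgetTriv π i).obj A ⟶ (forgetTriv π i).obj B ↦ k.hom.hom) e
    ext : 3
    exact e'⟩
  full := ⟨fun {A B} η ↦ by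
    have : IsIso η.hom.hom := η.property.1
    let f : A.obj.obj ⟶ B.obj.obj := ⟨η.hom.hom⟩
    have : IsIso f.α := this
    exact ⟨⟨⟨f⟩, isSmoothHom_of_isIso f A.obj.property.triv B.obj.property.triv⟩, rfl⟩⟩
  essSurj := ⟨fun F ↦ by
    obtain ⟨A, rfl⟩ := h F
    exact ⟨A, ⟨Iso.refl _⟩⟩⟩

end Characterization


/-! ### Smooth transport along families of paths -/

section Wilson

variable {m : ℕ} {M : Type u} [TopologicalSpace M] [ChartedSpace (EuclideanSpace ℝ (Fin m)) M]
  {Gr : LieGroupoid.{u₁, v₁}} {T : Type u₂} [Category.{v₂} T]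
  {π : SurjSubmersion m M} {i : Gr.Obj ⥤ T} {F : P₁ m M ⥤ T}

theorem SurjSubmersion.exists_local_section (π : SurjSubmersion m M) (x₀ : M) :
    ∃ (σ : M → π.total) (V : Set M), IsOpen V ∧ x₀ ∈ V ∧ ContMDiffOn (𝓡 m) (𝓡 π.dim) ∞ σ V ∧
      ∀ x ∈ V, π.proj (σ x) = x := by
  obtain ⟨y₀, rfl⟩ := π.surj x₀
  obtain ⟨ρ, W, hW, hW₀, cρ, hρ, -⟩ := exists_local_fibre_shift (π.submersion.isSubmersionAt y₀)
  have h : ContMDiff (𝓡 m) ((𝓡 m).prod (𝓡 π.dim)) ∞ fun x : M ↦ (x, y₀) :=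
    contMDiff_id.prodMk contMDiff_const
  exact ⟨fun x ↦ ρ (x, y₀), (fun x ↦ (x, y₀)) ⁻¹' W, hW.preimage h.continuous, hW₀,
    cρ.comp h.contMDiffOn fun _ hx ↦ hx, fun x hx ↦ hρ _ hx⟩

namespace LocalTrivialization

/-- The morphism of `Gr` that represents the value of `F` on a morphism `φ : x ⟶ x'` of the path
groupoid of the base, with respect to the trivialization at points `y` and `y'` over `x` and `x'`. -/
noncomputable def wilson [i.Full] (L : LocalTrivialization π i F) {y y' : π.total} {x x' : M}
    (h : π.proj y = x) (h' : π.proj y' = x') (φ : (⟨x⟩ : P₁ m M) ⟶ ⟨x'⟩) :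
    L.triv.obj ⟨y⟩ ⟶ L.triv.obj ⟨y'⟩ :=
  i.preimage (L.t.inv.app ⟨y⟩ ≫
    F.map (eqToHom (show π.push.obj ⟨y⟩ = (⟨x⟩ : P₁ m M) from congrArg PathGroupoid.mk h) ≫ φ ≫
      eqToHom (show (⟨x'⟩ : P₁ m M) = π.push.obj ⟨y'⟩ from congrArg PathGroupoid.mk h'.symm)) ≫
    L.t.hom.app ⟨y'⟩)

variable (L : LocalTrivialization π i F)

theorem map_wilson [i.Full] {y y' : π.total} {x x' : M} (h : π.proj y = x) (h' : π.proj y' = x')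
    (φ : (⟨x⟩ : P₁ m M) ⟶ ⟨x'⟩) :
    i.map (L.wilson h h' φ) = L.t.inv.app ⟨y⟩ ≫
      F.map (eqToHom (show π.push.obj ⟨y⟩ = (⟨x⟩ : P₁ m M) from congrArg PathGroupoid.mk h) ≫ φ ≫
        eqToHom (show (⟨x'⟩ : P₁ m M) = π.push.obj ⟨y'⟩ from congrArg PathGroupoid.mk h'.symm)) ≫
      L.t.hom.app ⟨y'⟩ :=
  i.map_preimage _

theorem wilson_comp [i.Full] [i.Faithful] {y y' y'' : π.total} {x x' x'' : M} (h : π.proj y = x)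
    (h' : π.proj y' = x') (h'' : π.proj y'' = x'') (φ : (⟨x⟩ : P₁ m M) ⟶ ⟨x'⟩)
    (ψ : (⟨x'⟩ : P₁ m M) ⟶ ⟨x''⟩) :
    L.wilson h h' φ ≫ L.wilson h' h'' ψ = L.wilson h h'' (φ ≫ ψ) := by
  apply i.map_injective
  simp [map_wilson]

theorem wilson_congr [i.Full] {y y' : π.total} {x x' z z' : M} (h : π.proj y = x)
    (h' : π.proj y' = x') (k : π.proj y = z) (k' : π.proj y' = z') (p : SPath (𝓡 m) (id : M → M) x x')
    (q : SPath (𝓡 m) (id : M → M) z z') (e : p.toFun = q.toFun) :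
    L.wilson h h' p.cls = L.wilson k k' q.cls := by
  subst h h' k k'
  rw [SPath.ext_toFun e]

theorem wilson_of_lift [i.Full] [i.Faithful] {y y' : π.total} {x x' : M} (h : π.proj y = x)
    (h' : π.proj y' = x') (γ : SPath (𝓡 π.dim) (id : π.total → π.total) y y')
    (p : SPath (𝓡 m) (id : M → M) x x') (e : ∀ t, p.toFun t = π.proj (γ.toFun t)) :
    L.wilson h h' p.cls = L.triv.map γ.cls := by
  subst h h'
  have : p = γ.map π.restrictsSmooth_proj := SPath.ext_toFun (funext e)
  subst this
  apply i.map_injective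
  have key : L.t.inv.app ⟨y⟩ ≫
      F.map (𝟙 (π.push.obj ⟨y⟩) ≫ π.push.map γ.cls ≫ 𝟙 (π.push.obj ⟨y'⟩)) ≫ L.t.hom.app ⟨y'⟩ =
        i.map (L.triv.map γ.cls) := by
    rw [Category.id_comp, Category.comp_id]
    exact NatIso.naturality_1 L.t γ.cls
  exact (L.map_wilson rfl rfl _).trans key

theorem map_wilson_id [i.Full] {y y' : π.total} {x : M} (h : π.proj y = x) (h' : π.proj y' = x) :
    i.map (L.wilson h h' (𝟙 _)) = L.transition.hom.app ⟨⟨(y, y'), h.trans h'.symm⟩⟩ := by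
  rw [transition_app, map_wilson, Category.id_comp, eqToHom_trans]
  rfl

section Smooth

variable {k : ℕ}

/-- `α` is, near `u₀`, a smooth lift of the family of points `x`. -/
def _root_.Transport.SurjSubmersion.IsLiftAt (π : SurjSubmersion m M)
    (x : EuclideanSpace ℝ (Fin k) → M)
    (α : EuclideanSpace ℝ (Fin k) → π.total) (u₀ : EuclideanSpace ℝ (Fin k)) : Prop :=
  ContMDiffAt (𝓡 k) (𝓡 π.dim) ∞ α u₀ ∧ ∀ᶠ u in 𝓝 u₀, π.proj (α u) = x u

theorem _root_.Transport.SurjSubmersion.exists_isLiftAt (π : SurjSubmersion m M)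
    {x : EuclideanSpace ℝ (Fin k) → M} {u₀ : EuclideanSpace ℝ (Fin k)}
    (hx : ContMDiffAt (𝓡 k) (𝓡 m) ∞ x u₀) : ∃ α, π.IsLiftAt x α u₀ := by
  obtain ⟨σ, V, hV, hxV, hσ, h⟩ := π.exists_local_section (x u₀)
  refine ⟨σ ∘ x, (hσ.contMDiffAt (hV.mem_nhds hxV)).comp _ hx, ?_⟩
  filter_upwards [hx.continuousAt.eventually (hV.mem_nhds hxV)] with u hu
  exact h _ hu

/-- The family of morphisms of `Gr` that represents a family `φ` of morphisms of the path groupoid of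
the base, with respect to the trivialization at `α` and `β`, is smooth at `u₀`. The family itself is
defined only where `α` and `β` lie over the end points of `φ`, so it is required to agree near `u₀` with a
map `f` defined everywhere. -/
def SmoothWilsonAt [i.Full] (L : LocalTrivialization π i F)
    (α β : EuclideanSpace ℝ (Fin k) → π.total)
    {x x' : EuclideanSpace ℝ (Fin k) → M} (φ : ∀ u, (⟨x u⟩ : P₁ m M) ⟶ ⟨x' u⟩)
    (u₀ : EuclideanSpace ℝ (Fin k)) : Prop :=
  ∃ f : EuclideanSpace ℝ (Fin k) → Mor Gr.Obj, SmoothMapAt (𝓡 k) f u₀ ∧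
    ∀ᶠ u in 𝓝 u₀, ∃ (h : π.proj (α u) = x u) (h' : π.proj (β u) = x' u),
      f u = ⟨_, _, L.wilson h h' (φ u)⟩

variable {L} {x x' x'' : EuclideanSpace ℝ (Fin k) → M} {u₀ : EuclideanSpace ℝ (Fin k)}
  {α β δ : EuclideanSpace ℝ (Fin k) → π.total}

theorem SmoothWilsonAt.comp [i.Full] [i.Faithful]
    {φ : ∀ u, (⟨x u⟩ : P₁ m M) ⟶ ⟨x' u⟩} {ψ : ∀ u, (⟨x' u⟩ : P₁ m M) ⟶ ⟨x'' u⟩}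
    (hφ : L.SmoothWilsonAt α β φ u₀) (hψ : L.SmoothWilsonAt β δ ψ u₀) :
    L.SmoothWilsonAt α δ (fun u ↦ φ u ≫ ψ u) u₀ := by
  obtain ⟨f, hf, ef⟩ := hφ
  obtain ⟨g, hg, eg⟩ := hψ
  obtain ⟨c, hc, ec⟩ := hf.exists_mor_comp hg (by
    filter_upwards [ef, eg] with u ⟨_, _, e⟩ ⟨_, _, e'⟩
    rw [e, e'])
  refine ⟨c, hc, ?_⟩
  filter_upwards [ef, eg, ec] with u ⟨h, h', e⟩ ⟨k, k', e'⟩ ⟨h₁, e₁⟩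
  refine ⟨h, k', e₁.trans ?_⟩
  rw [← L.wilson_comp h h' k' (φ u) (ψ u), ← Mor.comp_mk]
  congr 1

/-- Two smooth lifts of the same family of points are compared by the smooth transition of the
descent data. -/
theorem smoothWilsonAt_id [i.Full] [i.Faithful] (hL : ((extract π i).obj ⟨F, L⟩).IsSmooth)
    (hα : π.IsLiftAt x α u₀) (hβ : π.IsLiftAt x β u₀) :
    L.SmoothWilsonAt α β (fun u ↦ 𝟙 (⟨x u⟩ : P₁ m M)) u₀ := by
  obtain ⟨g, hg, hgs⟩ := hL.g
  have h₀ : ∀ᶠ u in 𝓝 u₀, π.proj (α u) = π.proj (β u) := by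
    filter_upwards [hα.2, hβ.2] with u h h'
    rw [h, h']
  classical
  let q : EuclideanSpace ℝ (Fin k) → π.Fib₂ := fun u ↦
    if h : π.proj (α u) = π.proj (β u) then ⟨(α u, β u), h⟩ else ⟨(α u, α u), rfl⟩
  have hq : ContMDiffAt (𝓡 k) ((𝓡 π.dim).prod (𝓡 π.dim)) ∞ (Subtype.val ∘ q) u₀ := by
    refine (hα.1.prodMk hβ.1).congr_of_eventuallyEq ?_
    filter_upwards [h₀] with u h
    simp only [Function.comp, q, dif_pos h]
  refine ⟨_, SmoothMap.comp_smoothMapAt hgs hq, ?_⟩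
  filter_upwards [hα.2, hβ.2] with u h h'
  refine ⟨h, h', ?_⟩
  have e : q u = ⟨(α u, β u), h.trans h'.symm⟩ := dif_pos _
  have e' : g.hom.app ⟨⟨(α u, β u), h.trans h'.symm⟩⟩ = L.wilson h h' (𝟙 _) := by
    exact i.map_injective ((hg _).symm.trans (L.map_wilson_id h h').symm)
  simp only [Function.comp]
  rw [e, e']
  rfl

/-- Over a short piece of a smooth family of curves, there are smooth lifts of the end points for
which transport is represented by a smooth family: a local section of the submersion lifts
the whole family, and `triv` is smooth. -/
theorem exists_smoothWilsonAt_segment [i.Full] [i.Faithful] (hL : SmoothFunctor L.triv)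
    {U : Set (EuclideanSpace ℝ (Fin k))} (hU : IsOpen U) (hu : u₀ ∈ U)
    {Γ : EuclideanSpace ℝ (Fin k) → ℝ → M} (hΓ : ∀ u, ContMDiff 𝓘(ℝ, ℝ) (𝓡 m) ∞ (id ∘ Γ u))
    (hs : ContMDiffOn 𝓘(ℝ, EuclideanSpace ℝ (Fin k) × ℝ) (𝓡 m) ∞ (fun p ↦ Γ p.1 p.2) (U ×ˢ univ))
    (t₀ : ℝ) :
    ∃ S ∈ 𝓝 t₀, ∀ a ∈ S, ∀ b ∈ S, ∃ α β, π.IsLiftAt (fun u ↦ Γ u a) α u₀ ∧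
      π.IsLiftAt (fun u ↦ Γ u b) β u₀ ∧
      L.SmoothWilsonAt α β (fun u ↦ (SPath.segment (Γ u) (hΓ u) a b).cls) u₀ := by
  obtain ⟨σ, V, hV, hxV, hσ, hσV⟩ := π.exists_local_section (Γ u₀ t₀)
  have hΓo : IsOpen ((U ×ˢ univ) ∩ (fun p : EuclideanSpace ℝ (Fin k) × ℝ ↦ Γ p.1 p.2) ⁻¹' V) :=
    hs.continuousOn.isOpen_inter_preimage (hU.prod isOpen_univ) hV
  obtain ⟨ε, hε, hB⟩ := Metric.isOpen_iff.1 hΓo (u₀, t₀) ⟨⟨hu, mem_univ _⟩, hxV⟩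
  rw [← ball_prod_same] at hB
  set O := Metric.ball u₀ ε
  set S := Metric.ball t₀ ε
  have hlift : ContMDiffOn 𝓘(ℝ, EuclideanSpace ℝ (Fin k) × ℝ) (𝓡 π.dim) ∞
      (fun p ↦ σ (Γ p.1 p.2)) (O ×ˢ S) :=
    hσ.comp (hs.mono fun p hp ↦ (hB hp).1) fun p hp ↦ (hB hp).2
  have hat : ∀ a ∈ S, π.IsLiftAt (fun u ↦ Γ u a) (fun u ↦ σ (Γ u a)) u₀ := by
    intro a ha
    have h1 : ContDiff ℝ ∞ fun u : EuclideanSpace ℝ (Fin k) ↦ (u, a) := by fun_prop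
    have h2 : ContMDiffOn (𝓡 k) (𝓡 π.dim) ∞
        ((fun p : EuclideanSpace ℝ (Fin k) × ℝ ↦ σ (Γ p.1 p.2)) ∘ fun u ↦ (u, a)) O :=
      hlift.comp h1.contMDiff.contMDiffOn fun u hu ↦ ⟨hu, ha⟩
    refine ⟨h2.contMDiffAt (Metric.ball_mem_nhds _ hε), ?_⟩
    filter_upwards [Metric.ball_mem_nhds u₀ hε] with u hu
    exact hσV _ (hB (⟨hu, ha⟩ : (u, a) ∈ O ×ˢ S)).2
  refine ⟨S, Metric.ball_mem_nhds _ hε, fun a ha b hb ↦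
    ⟨fun u ↦ σ (Γ u a), fun u ↦ σ (Γ u b), hat a ha, hat b hb, ?_⟩⟩
  have hmem : ∀ t, a + (b - a) * SPath.step t ∈ S := by
    intro t
    have := (convex_ball t₀ ε).add_smul_sub_mem ha hb ⟨SPath.step_nonneg t, SPath.step_le_one t⟩
    rwa [smul_eq_mul, mul_comm] at this
  have hτ : ContDiff ℝ ∞ fun p : EuclideanSpace ℝ (Fin k) × ℝ ↦
      (p.1, a + (b - a) * SPath.step p.2) := by
    have := SPath.step_contDiff
    fun_prop
  have hfam : ContMDiffOn 𝓘(ℝ, EuclideanSpace ℝ (Fin k) × ℝ) (𝓡 π.dim) ∞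
      ((fun p : EuclideanSpace ℝ (Fin k) × ℝ ↦ σ (Γ p.1 p.2)) ∘
        fun p ↦ (p.1, a + (b - a) * SPath.step p.2)) (O ×ˢ univ) :=
    hlift.comp hτ.contMDiff.contMDiffOn fun p hp ↦ ⟨hp.1, hmem _⟩
  let c' : ∀ u ∈ O, SPath (𝓡 π.dim) (id : π.total → π.total) (σ (Γ u a)) (σ (Γ u b)) := fun u hu ↦
    { toFun := fun t ↦ σ (Γ u (a + (b - a) * SPath.step t))
      smooth := by
        have h1 : ContDiff ℝ ∞ fun t : ℝ ↦ (u, t) := by fun_prop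
        have h2 := hfam.comp (s := univ) h1.contMDiff.contMDiffOn fun t _ ↦ ⟨hu, mem_univ _⟩
        exact contMDiffOn_univ.1 h2
      sitting := by
        refine ⟨1 / 3, by norm_num, by norm_num, fun t ht ↦ ?_, fun t ht ↦ ?_⟩
        · rw [SPath.step_zero ht.le, mul_zero, add_zero]
        · rw [SPath.step_one (by linarith), mul_one, add_sub_cancel] }
  classical
  let C : EuclideanSpace ℝ (Fin k) → PathSpace (𝓡 π.dim) (id : π.total → π.total) := fun u ↦
    if hu : u ∈ O then ⟨_, _, c' u hu⟩ else ⟨_, _, SPath.const _ _ (σ (Γ u a))⟩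
  have hC : ∀ u, ∀ hu : u ∈ O, C u = ⟨_, _, c' u hu⟩ := fun u hu ↦ dif_pos hu
  have hCs : ContMDiffOn 𝓘(ℝ, EuclideanSpace ℝ (Fin k) × ℝ) (𝓡 π.dim) ∞
      (fun p ↦ id ((C p.1).path.toFun p.2)) (O ×ˢ Icc 0 1) := by
    refine (hfam.mono (prod_mono_right (subset_univ _))).congr ?_
    rintro ⟨u, t⟩ ⟨hu, -⟩
    change (C u).path.toFun t = _
    rw [hC u hu]
    rfl
  refine ⟨_, hL.smoothMapAt Metric.isOpen_ball C hCs (Metric.mem_ball_self hε), ?_⟩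
  filter_upwards [Metric.ball_mem_nhds u₀ hε] with u hu
  have hπ : ∀ s ∈ S, π.proj (σ (Γ u s)) = Γ u s := fun s hs ↦
    hσV _ (hB (⟨hu, hs⟩ : (u, s) ∈ O ×ˢ S)).2
  refine ⟨hπ a ha, hπ b hb, ?_⟩
  rw [hC u hu, L.wilson_of_lift _ _ (c' u hu)]
  exact fun t ↦ (hπ _ (hmem t)).symm

/-- The segments of a smooth family of curves have smooth transport, for all smooth lifts of the end
points: the relation on parameters to have this property is transitive, and it holds for
parameters close to each other. -/
theorem smoothWilsonAt_segment [i.Full] [i.Faithful]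
    (hL : ((extract π i).obj ⟨F, L⟩).IsSmooth)
    {U : Set (EuclideanSpace ℝ (Fin k))} (hU : IsOpen U) (hu : u₀ ∈ U)
    {Γ : EuclideanSpace ℝ (Fin k) → ℝ → M} (hΓ : ∀ u, ContMDiff 𝓘(ℝ, ℝ) (𝓡 m) ∞ (id ∘ Γ u))
    (hs : ContMDiffOn 𝓘(ℝ, EuclideanSpace ℝ (Fin k) × ℝ) (𝓡 m) ∞ (fun p ↦ Γ p.1 p.2) (U ×ˢ univ))
    (a b : ℝ) (hα : π.IsLiftAt (fun u ↦ Γ u a) α u₀) (hβ : π.IsLiftAt (fun u ↦ Γ u b) β u₀) :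
    L.SmoothWilsonAt α β (fun u ↦ (SPath.segment (Γ u) (hΓ u) a b).cls) u₀ := by
  let R : ℝ → ℝ → Prop := fun a b ↦ ∀ α β, π.IsLiftAt (fun u ↦ Γ u a) α u₀ →
    π.IsLiftAt (fun u ↦ Γ u b) β u₀ →
    L.SmoothWilsonAt α β (fun u ↦ (SPath.segment (Γ u) (hΓ u) a b).cls) u₀
  have hloc : ∀ a, ∀ᶠ b in 𝓝 a, R a b ∧ R b a := by
    intro t₀
    obtain ⟨S, hS, h⟩ := exists_smoothWilsonAt_segment (L := L) hL.triv hU hu hΓ hs t₀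
    have : ∀ a ∈ S, ∀ b ∈ S, R a b := by
      intro a ha b hb α β hα hβ
      obtain ⟨α', β', hα', hβ', h'⟩ := h a ha b hb
      simpa using ((smoothWilsonAt_id hL hα hα').comp h').comp (smoothWilsonAt_id hL hβ' hβ)
    filter_upwards [hS] with b hb
    exact ⟨this _ (mem_of_mem_nhds hS) _ hb, this _ hb _ (mem_of_mem_nhds hS)⟩
  have htrans : IsTrans ℝ R := ⟨fun a b c hab hbc α δ hα hδ ↦ by
    have h1 : ContDiff ℝ ∞ fun u : EuclideanSpace ℝ (Fin k) ↦ (u, b) := by fun_prop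
    have h2 : ContMDiffOn (𝓡 k) (𝓡 m) ∞
        ((fun p : EuclideanSpace ℝ (Fin k) × ℝ ↦ Γ p.1 p.2) ∘ fun u ↦ (u, b)) U :=
      hs.comp h1.contMDiff.contMDiffOn fun u hu ↦ ⟨hu, mem_univ _⟩
    obtain ⟨β, hβ⟩ := π.exists_isLiftAt (h2.contMDiffAt (hU.mem_nhds hu))
    simpa only [SPath.segment_concat] using (hab α β hα hβ).comp (hbc β δ hβ hδ)⟩
  exact PreconnectedSpace.induction₂' R hloc htrans a b α β hα hβ

/-- Transport along a smooth family of paths is smooth, for all smooth lifts of the end points. -/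
theorem smoothWilsonAt_cls [i.Full] [i.Faithful]
    (hL : ((extract π i).obj ⟨F, L⟩).IsSmooth)
    {U : Set (EuclideanSpace ℝ (Fin k))} (hU : IsOpen U) (hu : u₀ ∈ U)
    (c : ∀ u, SPath (𝓡 m) (id : M → M) (x u) (x' u))
    (hc : ContMDiffOn 𝓘(ℝ, EuclideanSpace ℝ (Fin k) × ℝ) (𝓡 m) ∞
      (fun p ↦ (c p.1).toFun p.2) (U ×ˢ Icc 0 1))
    (hα : π.IsLiftAt x α u₀) (hβ : π.IsLiftAt x' β u₀) :
    L.SmoothWilsonAt α β (fun u ↦ (c u).cls) u₀ := by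
  -- The family is smooth on `[0,1]` only; composed with the step function it is smooth on the line.
  have hstep : ContDiff ℝ ∞ fun p : EuclideanSpace ℝ (Fin k) × ℝ ↦ (p.1, SPath.step p.2) := by
    have := SPath.step_contDiff
    fun_prop
  have hs : ContMDiffOn 𝓘(ℝ, EuclideanSpace ℝ (Fin k) × ℝ) (𝓡 m) ∞
      ((fun p : EuclideanSpace ℝ (Fin k) × ℝ ↦ (c p.1).toFun p.2) ∘
        fun p ↦ (p.1, SPath.step p.2)) (U ×ˢ univ) :=
    hc.comp hstep.contMDiff.contMDiffOn fun p hp ↦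
      ⟨hp.1, SPath.step_nonneg _, SPath.step_le_one _⟩
  have e0 : ∀ u, (c u).slow.toFun 0 = x u := fun u ↦ (c u).slow.apply_zero
  have e1 : ∀ u, (c u).slow.toFun 1 = x' u := fun u ↦ (c u).slow.apply_one
  obtain ⟨f, hf, hf'⟩ := smoothWilsonAt_segment hL hU hu (Γ := fun u ↦ (c u).slow.toFun)
    (fun u ↦ (c u).slow.smooth) hs 0 1 (α := α) (β := β)
    (by simpa only [e0] using hα) (by simpa only [e1] using hβ)
  refine ⟨f, hf, ?_⟩
  filter_upwards [hf'] with u ⟨h, h', e⟩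
  refine ⟨h.trans (e0 u), h'.trans (e1 u), e.trans ?_⟩
  rw [← SPath.cls_slow (c u), ← SPath.cls_slow (c u).slow]
  rw [L.wilson_congr h h' (h.trans (e0 u)) (h'.trans (e1 u)) _ (c u).slow.slow]
  funext t
  simp [SPath.segment, SPath.slow]

end Smooth

end LocalTrivialization

end Wilson


/-! ### The trivialization over a contractible submersion -/

section Contraction

variable {m : ℕ} {M : Type u} [TopologicalSpace M] [ChartedSpace (EuclideanSpace ℝ (Fin m)) M]

theorem eventually_connectedComponents_eq {n : ℕ} {Y : Type*} [TopologicalSpace Y]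
    [ChartedSpace (EuclideanSpace ℝ (Fin n)) Y] (y₀ : Y) :
    ∀ᶠ y : Y in 𝓝 y₀, (y : ConnectedComponents Y) = y₀ := by
  have : LocallyConnectedSpace Y :=
    ChartedSpace.locallyConnectedSpace (EuclideanSpace ℝ (Fin n)) Y
  filter_upwards [isOpen_connectedComponent.mem_nhds (mem_connectedComponent (x := y₀))] with y hy
  exact ConnectedComponents.coe_eq_coe'.2 hy

/-- A contraction of the total space of a submersion, as a family of paths from each point `y` to the
base point `b k` of its component `k`, smooth in the sense that smooth families of points yield
smooth families of paths. -/
structure Contraction (π : SurjSubmersion m M) where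
  b : ConnectedComponents π.total → π.total
  path : ∀ y : π.total, SPath (𝓡 π.dim) (id : π.total → π.total) y (b y)
  smooth : ∀ {k : ℕ} {U : Set (EuclideanSpace ℝ (Fin k))} {y : EuclideanSpace ℝ (Fin k) → π.total},
    ContMDiffOn (𝓡 k) (𝓡 π.dim) ∞ y U →
    ContMDiffOn 𝓘(ℝ, EuclideanSpace ℝ (Fin k) × ℝ) (𝓡 π.dim) ∞
      (fun p ↦ (path (y p.1)).toFun p.2) (U ×ˢ univ)

theorem SurjSubmersion.IsContractible.nonempty_contraction {π : SurjSubmersion m M}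
    (h : π.IsContractible) : Nonempty (Contraction π) := by
  obtain ⟨c, b, hc, -, h0, h1⟩ := h
  have hmem (t : ℝ) : SPath.step t ∈ Icc (0 : ℝ) 1 := ⟨SPath.step_nonneg t, SPath.step_le_one t⟩
  refine ⟨⟨b, fun y ↦ ⟨fun t ↦ c (y, SPath.step t), ?_, ?_⟩, ?_⟩⟩
  · have h : ContMDiff 𝓘(ℝ, ℝ) ((𝓡 π.dim).prod 𝓘(ℝ, ℝ)) ∞ (fun t ↦ (y, SPath.step t)) :=
      contMDiff_const.prodMk SPath.step_contDiff.contMDiff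
    exact contMDiffOn_univ.1 (hc.comp h.contMDiffOn fun t _ ↦ ⟨mem_univ _, hmem t⟩)
  · refine ⟨1 / 3, by norm_num, by norm_num, fun t ht ↦ ?_, fun t ht ↦ ?_⟩
    · rw [SPath.step_zero ht.le, h0]
    · rw [SPath.step_one (by linarith), h1]
  · intro k U y hy
    have h2 : ContMDiffOn 𝓘(ℝ, EuclideanSpace ℝ (Fin k) × ℝ) (𝓡 π.dim) ∞
        (fun p : EuclideanSpace ℝ (Fin k) × ℝ ↦ y p.1) (U ×ˢ univ) :=
      hy.comp contDiff_fst.contMDiff.contMDiffOn fun p hp ↦ hp.1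
    have h3 : ContMDiff 𝓘(ℝ, EuclideanSpace ℝ (Fin k) × ℝ) 𝓘(ℝ, ℝ) ∞
        (fun p : EuclideanSpace ℝ (Fin k) × ℝ ↦ SPath.step p.2) :=
      (SPath.step_contDiff.comp contDiff_snd).contMDiff
    exact hc.comp (h2.prodMk h3.contMDiffOn) fun p _ ↦ ⟨mem_univ _, hmem p.2⟩

variable {Gr : LieGroupoid.{u₁, v₁}} {T : Type u₂} [Category.{v₂} T]
  {π : SurjSubmersion m M} (κ : Contraction π) (i : Gr.Obj ⥤ T) [i.EssSurj] (F : P₁ m M ⥤ T)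

namespace Contraction

/-- An object of `Gr` that represents the value of `F` at the base point of a component. -/
noncomputable def fibre (k : ConnectedComponents π.total) : Gr.Obj :=
  i.objPreimage (F.obj (π.push.obj ⟨κ.b k⟩))

/-- The identification of the chosen object with the value of `F` at the base point. -/
noncomputable def fibreIso (k : ConnectedComponents π.total) :
    i.obj (κ.fibre i F k) ≅ F.obj (π.push.obj ⟨κ.b k⟩) :=
  i.objObjPreimageIso _

/-- Transport to the base point along the contraction. -/
noncomputable def frame (y : π.P₁Total) :
    F.obj (π.push.obj y) ≅ i.obj (κ.fibre i F (y.pt : ConnectedComponents π.total)) :=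
  F.mapIso (asIso (π.push.map (κ.path y.pt).cls)) ≪≫ (κ.fibreIso i F _).symm

/-- The local trivialization determined by a contraction: the fibres of `F` over a component are
identified by transport along the contraction with one object of `Gr`. -/
noncomputable def trivialization [i.Full] [i.Faithful] : LocalTrivialization π i F where
  triv :=
    { obj := fun y ↦ κ.fibre i F (y.pt : ConnectedComponents π.total)
      map := fun {y y'} γ ↦
        i.preimage ((κ.frame i F y).inv ≫ F.map (π.push.map γ) ≫ (κ.frame i F y').hom)
      map_id := fun y ↦ i.map_injective (by simp)
      map_comp := fun γ γ' ↦ i.map_injective (by simp) }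
  t := NatIso.ofComponents (fun y ↦ κ.frame i F y) fun γ ↦ by simp

end Contraction

/-- Conjugating by morphisms `s ≫ t` and `t' ≫ s'` replaces the frames `t`, `t'` by the frames
`s`, `s'`. -/
theorem map_preimage_reframe {P B : Type*} [Category P] [Category B] (i : B ⥤ T) [i.Full] (F : P ⥤ T)
    {p q p' q' : P} (e : q = p) (e' : q' = p') (φ : p ⟶ p') {A C D A' : B} (s : i.obj A ⟶ F.obj p)
    (t : F.obj q ≅ i.obj C) (t' : F.obj q' ≅ i.obj D) (s' : F.obj p' ⟶ i.obj A') (w : C ⟶ D)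
    (hw : i.map w = t.inv ≫ F.map (eqToHom e ≫ φ ≫ eqToHom e'.symm) ≫ t'.hom) :
    i.map (i.preimage (s ≫ F.map (eqToHom e.symm) ≫ t.hom) ≫ w ≫
      i.preimage (t'.inv ≫ F.map (eqToHom e') ≫ s')) = s ≫ F.map φ ≫ s' := by
  subst e e'
  simp [hw]

namespace Contraction

variable {i F} [i.Full] [i.Faithful]

/-- The trivialization determined by a contraction, expressed by a trivialization `L` over another
submersion: up to fixed morphisms of `Gr`, which compare the two at the base points, the morphism
assigned to a path is the one that `L` assigns to the loop that comes from the base point, runs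
through the path and goes back to the base point. -/
theorem trivialization_map_eq {π' : SurjSubmersion m M} (L : LocalTrivialization π' i F)
    (k k' : ConnectedComponents π.total) {z z' : π'.total} (hz : π'.proj z = π.proj (κ.b k))
    (hz' : π'.proj z' = π.proj (κ.b k')) :
    ∃ (a : κ.fibre i F k ⟶ L.triv.obj ⟨z⟩) (a' : L.triv.obj ⟨z'⟩ ⟶ κ.fibre i F k'),
      ∀ (y y' : π.total) (γ : SPath (𝓡 π.dim) (id : π.total → π.total) y y')
        (hy : (y : ConnectedComponents π.total) = k) (hy' : (y' : ConnectedComponents π.total) = k'),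
        (⟨_, _, (κ.trivialization i F).triv.map γ.cls⟩ : Mor Gr.Obj) =
          ⟨_, _, a ≫ L.wilson (hz.trans (by rw [hy])) (hz'.trans (by rw [hy']))
            ((((κ.path y).map π.restrictsSmooth_proj).reverse.cls ≫
              (γ.map π.restrictsSmooth_proj).cls) ≫
                ((κ.path y').map π.restrictsSmooth_proj).cls) ≫ a'⟩ := by
  have e : π'.push.obj ⟨z⟩ = π.push.obj ⟨κ.b k⟩ := congrArg PathGroupoid.mk hz
  have e' : π'.push.obj ⟨z'⟩ = π.push.obj ⟨κ.b k'⟩ := congrArg PathGroupoid.mk hz'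
  refine ⟨i.preimage ((κ.fibreIso i F k).hom ≫ F.map (eqToHom e.symm) ≫ L.t.hom.app ⟨z⟩),
    i.preimage (L.t.inv.app ⟨z'⟩ ≫ F.map (eqToHom e') ≫ (κ.fibreIso i F k').inv), ?_⟩
  intro y y' γ hy hy'
  subst hy hy'
  refine congrArg (Mor.mk _ _) (i.map_injective (Eq.trans ?_ (map_preimage_reframe i F e e' _ _
    (L.t.app ⟨z⟩) (L.t.app ⟨z'⟩) _ _ (L.map_wilson _ _ _)).symm))
  refine (i.map_preimage _).trans ?_
  let ψ : π.push.obj ⟨κ.b y⟩ ⟶ π.push.obj ⟨κ.b y'⟩ :=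
    (inv (π.push.map (κ.path y).cls) ≫ π.push.map γ.cls) ≫ π.push.map (κ.path y').cls
  have h : ψ = (((κ.path y).map π.restrictsSmooth_proj).reverse.cls ≫
      (γ.map π.restrictsSmooth_proj).cls) ≫ ((κ.path y').map π.restrictsSmooth_proj).cls :=
    congrArg (fun δ ↦ (δ ≫ (γ.map π.restrictsSmooth_proj).cls) ≫
      ((κ.path y').map π.restrictsSmooth_proj).cls) (SPath.cls_reverse _).symm
  refine Eq.trans ?_ (congrArg (fun δ ↦ (κ.fibreIso i F (y : ConnectedComponents π.total)).hom ≫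
    F.map δ ≫ (κ.fibreIso i F (y' : ConnectedComponents π.total)).inv) h)
  simp only [frame, ψ, Iso.trans_inv, Iso.trans_hom, Iso.symm_inv, Iso.symm_hom, Functor.mapIso_inv,
    Functor.mapIso_hom, asIso_inv, asIso_hom, F.map_comp, Category.assoc]
  rfl

/-- The trivialization determined by a contraction is smooth, if `F` has a trivialization with smooth
descent data over some submersion. -/
theorem smoothFunctor_trivialization {π' : SurjSubmersion m M} {L : LocalTrivialization π' i F}
    (hL : ((extract π' i).obj ⟨F, L⟩).IsSmooth) :
    SmoothFunctor (κ.trivialization i F).triv := by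
  constructor
  · refine smoothMap_of_smoothMapAt fun y₀ ↦
      ⟨_, (smoothMapAt_const (κ.fibre i F (y₀ : ConnectedComponents π.total)) _), ?_⟩
    rw [Filter.comap_id]
    filter_upwards [eventually_connectedComponents_eq (n := π.dim) y₀] with y hy
    exact congrArg (κ.fibre i F) hy
  · intro d U hU c hc
    refine (smoothMap_subtype_iff hU (f := fun u ↦
      (⟨_, _, (κ.trivialization i F).triv.map (c u).path.cls⟩ : Mor Gr.Obj))).2 fun u₀ hu ↦ ?_
    have hend : ∀ t ∈ Icc (0 : ℝ) 1, ContMDiffOn (𝓡 d) (𝓡 π.dim) ∞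
        (fun u ↦ (c u).path.toFun t) U := by
      intro t ht
      have h1 : ContDiff ℝ ∞ fun u : EuclideanSpace ℝ (Fin d) ↦ (u, t) := by fun_prop
      exact hc.comp h1.contMDiff.contMDiffOn fun u hu ↦ ⟨hu, ht⟩
    have hsrc : ContMDiffOn (𝓡 d) (𝓡 π.dim) ∞ (fun u ↦ (c u).src) U := by
      simpa only [SPath.apply_zero] using hend 0 (by simp)
    have htgt : ContMDiffOn (𝓡 d) (𝓡 π.dim) ∞ (fun u ↦ (c u).tgt) U := by
      simpa only [SPath.apply_one] using hend 1 (by simp)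
    have hsrc₀ := hsrc.contMDiffAt (hU.mem_nhds hu)
    have htgt₀ := htgt.contMDiffAt (hU.mem_nhds hu)
    have hπ := π.submersion.contMDiff
    -- Near `u₀` the end points of the paths stay in fixed components.
    have hk := hsrc₀.continuousAt.eventually (eventually_connectedComponents_eq (n := π.dim) (c u₀).src)
    have hk' := htgt₀.continuousAt.eventually (eventually_connectedComponents_eq (n := π.dim) (c u₀).tgt)
    obtain ⟨z, hz⟩ := π'.surj (π.proj (κ.b ((c u₀).src : ConnectedComponents π.total)))
    obtain ⟨z', hz'⟩ := π'.surj (π.proj (κ.b ((c u₀).tgt : ConnectedComponents π.total)))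
    obtain ⟨a, a', key⟩ := κ.trivialization_map_eq L _ _ hz hz'
    obtain ⟨α, hα⟩ := π'.exists_isLiftAt (x := fun u ↦ π.proj (c u).src)
      (hπ.contMDiffAt.comp _ hsrc₀)
    obtain ⟨β, hβ⟩ := π'.exists_isLiftAt (x := fun u ↦ π.proj (c u).tgt)
      (hπ.contMDiffAt.comp _ htgt₀)
    have lz : π'.IsLiftAt (fun u ↦ π.proj (κ.b (c u).src)) (fun _ ↦ z) u₀ := by
      refine ⟨contMDiffAt_const, ?_⟩
      filter_upwards [hk] with u hu
      rw [hz, hu]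
    have lz' : π'.IsLiftAt (fun u ↦ π.proj (κ.b (c u).tgt)) (fun _ ↦ z') u₀ := by
      refine ⟨contMDiffAt_const, ?_⟩
      filter_upwards [hk'] with u hu
      rw [hz', hu]
    have hrev : ContDiff ℝ ∞ fun p : EuclideanSpace ℝ (Fin d) × ℝ ↦ (p.1, 1 - p.2) := by fun_prop
    have w₁ := LocalTrivialization.smoothWilsonAt_cls hL hU hu
      (fun u ↦ ((κ.path (c u).src).map π.restrictsSmooth_proj).reverse)
      (hπ.comp_contMDiffOn ((κ.smooth hsrc).comp hrev.contMDiff.contMDiffOn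
        fun p hp ↦ ⟨hp.1, mem_univ _⟩)) lz hα
    have w₂ := LocalTrivialization.smoothWilsonAt_cls hL hU hu
      (fun u ↦ (c u).path.map π.restrictsSmooth_proj) (hπ.comp_contMDiffOn hc) hα hβ
    have w₃ := LocalTrivialization.smoothWilsonAt_cls hL hU hu
      (fun u ↦ (κ.path (c u).tgt).map π.restrictsSmooth_proj)
      (hπ.comp_contMDiffOn ((κ.smooth htgt).mono (prod_mono_right (subset_univ _)))) hβ lz'
    obtain ⟨f, hf, ef⟩ := (w₁.comp w₂).comp w₃
    obtain ⟨g, hg, eg⟩ := hf.exists_mor_comp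
      (smoothMapAt_const (⟨_, _, a'⟩ : Mor Gr.Obj) u₀) (by
        filter_upwards [ef] with u ⟨_, _, e⟩
        rw [e])
    refine (smoothMapAt_const (⟨_, _, a⟩ : Mor Gr.Obj) u₀).mor_comp hg ?_
    filter_upwards [hk, hk', ef, eg] with u h₁ h₂ ⟨_, _, e₁⟩ ⟨_, e₂⟩
    have e₃ := e₂.trans (by
      simp only [e₁]
      exact Mor.comp_mk _ a')
    rw [e₃]
    refine ⟨rfl, ?_⟩
    rw [Mor.comp_mk]
    exact key _ _ (c u).path h₁ h₂

end Contraction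

/-- Over a contractible submersion every transport functor has a local trivialization with smooth
descent data. -/
theorem surjective_forgetTriv_obj (i : Gr.Obj ⥤ T) [i.IsEquivalence]
    [(IsTransportHom m M i).IsMultiplicative] (hπ : π.IsContractible) :
    Function.Surjective (forgetTriv π i).obj := by
  rintro ⟨⟨F, π', L, hL⟩⟩
  obtain ⟨κ⟩ := hπ.nonempty_contraction
  exact ⟨⟨⟨⟨F, κ.trivialization i F⟩, DescentData.isSmooth_of_smooth_triv
    (κ.smoothFunctor_trivialization hL)⟩⟩, rfl⟩

end Contraction

end Transport

theorem mainTheorem6 {m : ℕ} {M : Type u} [TopologicalSpace M]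
    [ChartedSpace (EuclideanSpace ℝ (Fin m)) M] [IsManifold (𝓡 m) ∞ M] [T2Space M]
    [SecondCountableTopology M] (Gr : LieGroupoid.{u₁, v₁}) {T : Type u₂} [Category.{v₂} T]
    (i : Gr.Obj ⥤ T) [i.IsEquivalence] (π : SurjSubmersion m M) (hπ : π.IsContractible) :
    ∃ _ : (IsTransportHom m M i).IsMultiplicative,
      (forgetTriv π i).IsEquivalence ∧ Function.Surjective (forgetTriv π i).obj := by
  have hm := isMultiplicative_isTransportHom (m := m) (M := M) i
  have hs := surjective_forgetTriv_obj i hπ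
  exact ⟨hm, isEquivalence_forgetTriv hs, hs⟩
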